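/- **Setting.** For $f\in C_0^\infty(\mathbb R^2)$, $\omega\in S^1$, $p\in\mathbb R$ let $\mathcal Rf(\omega,p)=\int_{x\cdot\omega=p}f\,d\ell$, and let $\mathcal H=\frac1{4\pi}H\,\frac{d}{dp}$ act in the variable $p$, where $Hg(p)=\frac1\pi\,\mathrm{p.v.}\!\int\frac{g(t)}{p-t}\,dt$. Write $\omega(\varphi)=(\cos\varphi,\sin\varphi)$, $\xi^\perp=(-\xi_2,\xi_1)$, $\langle\xi\rangle=(1+|\xi|^2)^{1/2}$, and $\mathcal F_hf(\xi)=\int e^{-ix\cdot\xi/h}f(x)\,dx$ (extended to $L^2(\mathbb R^2)$ as usual). Fix $s>0$ and an even function $\psi\in C^\infty(S^1)$, and let $h$ run over the set $\{\pi/(sm): m=1,2,\dots\}$. A family $f_h$ is *semiclassically band-limited* if $f_h\in C_0^\infty(\mathbb R^2)$ with support in a compact set independent of $h$; some Sobolev norm $\|f_h\|_{H^\sigma}$ is bounded by $Ch^{-N}$ for some $C,N$; and there is a compact $\mathbf B\subset\mathbb R^2$ such that for every open $U\supset\mathbf B$ and every $N$ there is $C_N$ with $|\mathcal F_hf_h(\xi)|\le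 C_Nh^N\langle\xi\rangle^{-N}$ for all $\xi\notin U$ and all $h$. Put $$f_\psi(x)=\int_{S^1}\psi(\omega)(\mathcal H\mathcal Rf_h)(\omega,x\cdot\omega)\,d\omega,\qquad f_{\psi,\delta}(x)=2sh\sum_{j=1}^{m}\psi(\omega_j)(\mathcal H\mathcal Rf_h)(\omega_j,x\cdot\omega_j),\quad \omega_j=\omega(shj),\ h=\frac{\pi}{sm}.$$ For $k\in\mathbb Z$ let $\mathcal A_k$ be the operator on $L^2(\mathbb R^2)$ given by $\mathcal F_h(\mathcal A_kg)(\xi)=e^{2\pi ik\arg(\xi)/(sh)}\,\mathcal F_hg(\xi)$, and for $\xi\ne0$ let $$C_k(x,\xi)=\Big(x+\frac{2\pi k}{s|\xi|}\,\frac{\xi^\perp}{|\xi|},\ \xi\Big).$$ **Fourier integral operators.** Let $A=A_h$ be a family of bounded operators on $L^2(\mathbb R^2)$ with Schwartz kernels $\mathcal K_{A_h}$, and let $\Gamma\subset T^*\mathbb R^2\times T^*\mathbb R^2$. Two families of kernels *agree microlocally near* $((x_0,\xi_0),(y_0,\eta_0))$ if $(x_0,y_0,\xi_0,-\eta_0)$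 is not in the semiclassical wave front set of their difference $D$: there are $\chi_1,\chi_2\in C_0^\infty(\mathbb R^2)$ with $\chi_1(x_0)\chi_2(y_0)\ne0$ such that the semiclassical Fourier transform of $\overline{\chi_1(x)}\,\chi_2(y)D(x,y)$ is $O(h^\infty)$ uniformly near $(\xi_0,-\eta_0)$. We say that $A$ is, *away from the zero section, an elliptic semiclassical FIO of order zero with canonical relation $\Gamma$* if (i) near every point $c=((x_0,\xi_0),(y_0,\eta_0))\in\Gamma$ with $(\xi_0,\eta_0)\ne(0,0)$ its kernel agrees microlocally with an oscillatory integral $$(2\pi h)^{-(2+N)/2}\int_{\mathbb R^N}e^{i\Phi(x,y,\theta)/h}a(x,y,\theta;h)\,d\theta,$$ where $\Phi$ is a nondegenerate real phase function on an open set $\Omega$; the map $(x,y,\theta)\mapsto((x,\Phi_x),(y,-\Phi_y))$ is injective from the critical set $\{\Phi_\theta=0\}\subset\Omega$ into $\Gamma$, with image containing a neighbourhood of $c$ in $\Gamma$; $a(\cdot;h)$ is smooth, supported in a compact subset of $\Omega$ independent of $h$, with all derivatives bounded uniformly in $h$; and $|a|$ is bounded below by a positive constant, for all small $h$, at the critical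 point that corresponds to $c$; and (ii) its kernel agrees microlocally with $0$ near every other point with $(\xi_0,\eta_0)\ne(0,0)$. **Theorem.** Let $f_h$ be semiclassically band-limited. Then: (a) For every $h=\pi/(sm)$, the principal values and the circle integral above exist, $f_\psi\in L^2(\mathbb R^2)$ and $f_\psi=\psi(D/|D|)f_h$; each $\mathcal A_kf_\psi$ is (a.e. equal to) a continuous function, and $$f_{\psi,\delta}=f_\psi+\sum_{k\in\mathbb Z,\ k\ne0}\mathcal A_kf_\psi,$$ where the series converges unconditionally, locally uniformly on $\mathbb R^2$. (b) Each $\mathcal A_k$ is unitary on $L^2(\mathbb R^2)$. (c) Away from the zero section each $\mathcal A_k$ is an elliptic semiclassical FIO of order zero whose canonical relation is $\{((x,\xi),C_k(x,\xi)):\xi\ne0\}$, the graph of $C_k$. Here, as in the definition above, the first component $(x,\Phi_x)$ belongs to the output and the second component $(y,-\Phi_y)$ to the input of the operator. -/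

import Mathlib

open MeasureTheory Filter Topology FourierTransform
open scoped ContDiff ENNReal

noncomputable section

namespace DirectRecon

/-- The plane, with its Euclidean norm and Lebesgue measure. -/
abbrev Plane := EuclideanSpace ℝ (Fin 2)

/-- The complex Hilbert space of square integrable functions on the plane. -/
abbrev L2 := Lp (α := Plane) ℂ 2 volume

/-- Rotation by `π / 2`. -/
def perp (ξ : Plane) : Plane := !₂[-ξ 1, ξ 0]

/-- The unit vector with polar angle `φ`. -/
def omega (φ : ℝ) : Plane := !₂[Real.cos φ, Real.sin φ]

/-- The polar angle of `ξ`. -/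
def arg (ξ : Plane) : ℝ := Complex.arg (⟨ξ 0, ξ 1⟩ : ℂ)

/-- The admissible values of the semiclassical parameter: those with `π / (s h)` a positive
integer. -/
def admissible (s : ℝ) : Set ℝ := {h | ∃ m : ℕ, 1 ≤ m ∧ h = Real.pi / (s * m)}

/-! ### Semiclassically band-limited families -/

/-- Japanese bracket. -/
def bracket (ξ : Plane) : ℝ := Real.sqrt (1 + ‖ξ‖ ^ 2)

/-- Semiclassical Fourier transform `∫ exp (-i x · ξ / h) f x dx`. -/
def semiFourier (h : ℝ) (f : Plane → ℂ) (ξ : Plane) : ℂ :=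
  ∫ x, Complex.exp (-Complex.I * ((inner ℝ x ξ / h : ℝ) : ℂ)) * f x

/-- The Sobolev norm of order `σ` (for test functions). -/
def sobolevNorm (σ : ℝ) (f : Plane → ℂ) : ℝ :=
  Real.sqrt (∫ ξ, bracket ξ ^ (2 * σ) * ‖semiFourier 1 f ξ‖ ^ 2)

/-- The family `f h`, `h ∈ H`, is semiclassically band-limited. -/
structure IsBandLimited (H : Set ℝ) (f : ℝ → Plane → ℂ) : Prop where
  smooth : ∀ h ∈ H, ContDiff ℝ ∞ (f h)
  support : ∃ K : Set Plane, IsCompact K ∧ ∀ h ∈ H, tsupport (f h) ⊆ K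
  tempered : ∃ (σ : ℝ) (N : ℕ) (C : ℝ), ∀ h ∈ H, sobolevNorm σ (f h) ≤ C / h ^ N
  bandLimit : ∃ B : Set Plane, IsCompact B ∧ ∀ U : Set Plane, IsOpen U → B ⊆ U →
    ∀ N : ℕ, ∃ C : ℝ, ∀ h ∈ H, ∀ ξ, ξ ∉ U →
      ‖semiFourier h (f h) ξ‖ ≤ C * h ^ N / bracket ξ ^ N

/-! ### Filtered backprojection -/

/-- The integral of `f` over the line `x · e = p` with respect to length, for a unit vector `e`. -/
def radon (f : Plane → ℂ) (e : Plane) (p : ℝ) : ℂ := ∫ t : ℝ, f (p • e + t • perp e)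

/-- The truncated integral in the definition of the Hilbert transform. -/
def hilbertTrunc (g : ℝ → ℂ) (p ε : ℝ) : ℂ :=
  (1 / Real.pi : ℝ) * ∫ t in {t : ℝ | ε < |p - t|}, g t / ((p - t : ℝ) : ℂ)

/-- The Hilbert transform, a principal value integral. -/
def hilbert (g : ℝ → ℂ) (p : ℝ) : ℂ := limUnder (𝓝[>] (0 : ℝ)) (hilbertTrunc g p)

/-- The filter `(4 π)⁻¹ H d/dp`. -/
def ramp (g : ℝ → ℂ) (p : ℝ) : ℂ := (1 / (4 * Real.pi) : ℝ) * hilbert (deriv g) p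

/-- The localized Radon transform in the direction of angle `φ`. -/
def data (ψ : Plane → ℂ) (f : Plane → ℂ) (φ p : ℝ) : ℂ := ψ (omega φ) * radon f (omega φ) p

/-- The filtered data in the direction of angle `φ`, at the line through `x`. -/
def filteredAt (ψ : Plane → ℂ) (f : Plane → ℂ) (x : Plane) (φ : ℝ) : ℂ :=
  ramp (data ψ f φ) (inner ℝ x (omega φ))

/-- The filtered backprojection of the localized data known for all angles. -/
def fullRecon (ψ : Plane → ℂ) (f : Plane → ℂ) (x : Plane) : ℂ :=
  ∫ φ in (0 : ℝ)..(2 * Real.pi), filteredAt ψ f x φ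

/-- The direct reconstruction from the `m` angles `s h j`, `1 ≤ j ≤ m`. -/
def directRecon (ψ : Plane → ℂ) (f : Plane → ℂ) (s h : ℝ) (m : ℕ) (x : Plane) : ℂ :=
  (2 * s * h : ℝ) * ∑ j ∈ Finset.Icc 1 m, filteredAt ψ f x (s * h * j)

/-! ### The Fourier multipliers `A_k` -/

/-- The multiplier `exp (2 π i k arg ξ / (s h))`. -/
def phaseFactor (s h : ℝ) (k : ℤ) (ξ : Plane) : ℂ :=
  Complex.exp (Complex.I * ((2 * Real.pi * k * arg ξ / (s * h) : ℝ) : ℂ))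

lemma measurable_phaseFactor (s h : ℝ) (k : ℤ) : Measurable (phaseFactor s h k) := by
  have h0 : Measurable fun ξ : Plane => (⟨ξ 0, ξ 1⟩ : ℂ) := by
    have : (fun ξ : Plane => (⟨ξ 0, ξ 1⟩ : ℂ)) =
        fun ξ : Plane => ((ξ 0 : ℝ) : ℂ) + ((ξ 1 : ℝ) : ℂ) * Complex.I := by
      funext ξ
      exact Complex.mk_eq_add_mul_I _ _
    rw [this]
    fun_prop
  have h1 : Measurable arg := Complex.measurable_arg.comp h0
  unfold phaseFactor
  fun_prop

lemma memLp_phaseFactor (s h : ℝ) (k : ℤ) :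
    MemLp (fun w : Plane => phaseFactor s h k ((2 * Real.pi * h) • w)) ∞ volume := by
  refine memLp_top_of_bound (C := 1) ?_ (Eventually.of_forall fun w => ?_)
  · exact ((measurable_phaseFactor s h k).comp (measurable_const_smul _)).aestronglyMeasurable
  · rw [phaseFactor, mul_comm, Complex.norm_exp_ofReal_mul_I]

/-- Relation between the semiclassical Fourier transform and Mathlib's. -/
lemma semiFourier_eq (h : ℝ) (f : Plane → ℂ) (ξ : Plane) :
    semiFourier h f ξ = 𝓕 f ((2 * Real.pi * h)⁻¹ • ξ) := by
  rw [Real.fourier_eq']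
  unfold semiFourier
  congr 1
  funext x
  rw [smul_eq_mul, real_inner_smul_right]
  congr 2
  by_cases hh : h = 0
  · simp [hh]
  · have := Real.pi_ne_zero
    push_cast
    have h2 : (h : ℂ) ≠ 0 := by exact_mod_cast hh
    have h3 : (Real.pi : ℂ) ≠ 0 := by exact_mod_cast this
    field_simp

/-- The operator on `L2` that multiplies the semiclassical Fourier transform of a function, at the
frequency `ξ`, by `exp (2 π i k arg ξ / (s h))`. Since `F_h g ξ = 𝓕 g (ξ / (2 π h))`, the point `w`
in the range of Mathlib's transform `𝓕` stands for the frequency `ξ = 2 π h w`. -/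
def aliasOp (s h : ℝ) (k : ℤ) : L2 →L[ℂ] L2 :=
  ((Lp.fourierTransformₗᵢ Plane ℂ).symm : L2 →L[ℂ] L2) ∘L
    ((ContinuousLinearMap.mul ℂ ℂ).holderL volume ∞ 2 2 (memLp_phaseFactor s h k).toLp) ∘L
      ((Lp.fourierTransformₗᵢ Plane ℂ) : L2 →L[ℂ] L2)

/-! ### Semiclassical Fourier integral operators -/

/-- Smooth, compactly supported functions on the plane. -/
structure Cutoff where
  toFun : Plane → ℂ
  smooth : ContDiff ℝ ∞ toFun
  compact : HasCompactSupport toFun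

/-- The localized plane wave `χ x * exp (i x · ξ / h)`. -/
def Cutoff.wave (χ : Cutoff) (ξ : Plane) (h : ℝ) (x : Plane) : ℂ :=
  χ.toFun x * Complex.exp (Complex.I * ((inner ℝ x ξ / h : ℝ) : ℂ))

lemma Cutoff.memLp_wave (χ : Cutoff) (ξ : Plane) (h : ℝ) :
    MemLp (χ.wave ξ h) 2 volume := by
  have hc : Continuous (χ.wave ξ h) := by
    have := χ.smooth.continuous
    unfold Cutoff.wave
    fun_prop
  exact hc.memLp_of_hasCompactSupport χ.compact.mul_right

/-- The localized plane wave as an element of `L2`. -/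
def Cutoff.packet (χ : Cutoff) (ξ : Plane) (h : ℝ) : L2 := (χ.memLp_wave ξ h).toLp

/-- A point `((x, ξ), (y, η))` of the product of two copies of the phase space. -/
abbrev Phase2 := (Plane × Plane) × (Plane × Plane)

/-- The Schwartz kernels of the operators `A h` agree with the functions `K h` up to `O(h^∞)`,
microlocally near `c = ((x, ξ), (y, η))`, as `h → 0` within `H`. In terms of the semiclassical wave
front set: `(x, y, ξ, -η)` is not in the wave front set of the difference of the kernels, that is,
for suitable cut-offs with `χ₁ x ≠ 0`, `χ₂ y ≠ 0`, the semiclassical Fourier transform of the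
difference times `conj χ₁ ⊗ χ₂` is `O(h^∞)` near `(ξ, -η)`. -/
def AgreesNear (H : Set ℝ) (A : ℝ → L2 →L[ℂ] L2) (K : ℝ → Plane → Plane → ℂ) (c : Phase2) : Prop :=
  ∃ χ₁ χ₂ : Cutoff, χ₁.toFun c.1.1 ≠ 0 ∧ χ₂.toFun c.2.1 ≠ 0 ∧
    ∃ V ∈ 𝓝 (c.1.2, c.2.2), ∀ N : ℕ, ∃ C : ℝ, ∃ h₀ > 0, ∀ h ∈ H, h < h₀ → ∀ v ∈ V,
      ‖inner ℂ (χ₁.packet v.1 h) (A h (χ₂.packet v.2 h)) -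
        ∫ x, ∫ y, starRingEnd ℂ (χ₁.wave v.1 h x) * K h x y * χ₂.wave v.2 h y‖ ≤ C * h ^ N

section

variable {N : ℕ}

/-- `z = (x, y, θ)` is a critical point of the phase function `Φ` with respect to `θ`, and
`c = ((x, Φ_x), (y, -Φ_y))`. -/
structure CriticalOver (Φ : Plane × Plane × EuclideanSpace ℝ (Fin N) → ℝ)
    (z : Plane × Plane × EuclideanSpace ℝ (Fin N)) (c : Phase2) : Prop where
  crit : ∀ τ, fderiv ℝ Φ z (0, 0, τ) = 0
  left_point : c.1.1 = z.1
  left_covector : ∀ v, fderiv ℝ Φ z (v, 0, 0) = inner ℝ c.1.2 v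
  right_point : c.2.1 = z.2.1
  right_covector : ∀ v, fderiv ℝ Φ z (0, v, 0) = -inner ℝ c.2.2 v

/-- `Φ` is a nondegenerate phase function on the open set `Ω` that parametrizes (one to one) a piece
of the canonical relation `Γ` containing a neighbourhood of `c` in `Γ`. -/
structure Parametrizes (Φ : Plane × Plane × EuclideanSpace ℝ (Fin N) → ℝ)
    (Ω : Set (Plane × Plane × EuclideanSpace ℝ (Fin N))) (Γ : Set Phase2) (c : Phase2) : Prop where
  isOpen : IsOpen Ω
  smooth : ContDiffOn ℝ ∞ Φ Ω
  /-- The differentials of the functions `∂Φ/∂θ_j` are linearly independent on the critical set. -/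
  nondegenerate : ∀ z ∈ Ω, (∀ τ, fderiv ℝ Φ z (0, 0, τ) = 0) →
    ∀ τ, fderiv ℝ (fun z' => fderiv ℝ Φ z' (0, 0, τ)) z = 0 → τ = 0
  mem : ∀ z ∈ Ω, ∀ c', CriticalOver Φ z c' → c' ∈ Γ
  covers : ∃ O : Set Phase2, IsOpen O ∧ c ∈ O ∧ ∀ c' ∈ Γ ∩ O, ∃ z ∈ Ω, CriticalOver Φ z c'
  injective : ∀ z ∈ Ω, ∀ z' ∈ Ω, ∀ c', CriticalOver Φ z c' → CriticalOver Φ z' c' → z = z'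

/-- `a h`, `h ∈ H`, is an amplitude of order `μ` on `Ω`. -/
structure IsAmplitude (H : Set ℝ) (Ω : Set (Plane × Plane × EuclideanSpace ℝ (Fin N))) (μ : ℝ)
    (a : ℝ → Plane × Plane × EuclideanSpace ℝ (Fin N) → ℂ) : Prop where
  smooth : ∀ h ∈ H, ContDiff ℝ ∞ (a h)
  support : ∃ K, IsCompact K ∧ K ⊆ Ω ∧ ∀ h ∈ H, tsupport (a h) ⊆ K
  bound : ∀ n : ℕ, ∃ C : ℝ, ∀ h ∈ H, ∀ z, ‖iteratedFDeriv ℝ n (a h) z‖ ≤ C * h ^ (-μ)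

/-- The oscillatory integral
`(2 π h)^(-(2 + N) / 2) ∫ exp (i Φ(x, y, θ) / h) a(x, y, θ; h) dθ`. -/
def oscKernel (Φ : Plane × Plane × EuclideanSpace ℝ (Fin N) → ℝ)
    (a : ℝ → Plane × Plane × EuclideanSpace ℝ (Fin N) → ℂ) (h : ℝ) (x y : Plane) : ℂ :=
  ((2 * Real.pi * h) ^ (-((2 + N : ℝ) / 2)) : ℝ) *
    ∫ θ, Complex.exp (Complex.I * ((Φ (x, y, θ) / h : ℝ) : ℂ)) * a h (x, y, θ)

end

/-- Microlocally near the point `c` of the canonical relation `Γ`, the family `A` is a semiclassical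
Fourier integral operator of order `μ` associated with `Γ`, elliptic at `c`. -/
def IsEllipticFIOAt (H : Set ℝ) (A : ℝ → L2 →L[ℂ] L2) (Γ : Set Phase2) (μ : ℝ) (c : Phase2) :
    Prop :=
  ∃ (N : ℕ) (Φ : Plane × Plane × EuclideanSpace ℝ (Fin N) → ℝ)
    (Ω : Set (Plane × Plane × EuclideanSpace ℝ (Fin N)))
    (a : ℝ → Plane × Plane × EuclideanSpace ℝ (Fin N) → ℂ),
    Parametrizes Φ Ω Γ c ∧ IsAmplitude H Ω μ a ∧ AgreesNear H A (oscKernel Φ a) c ∧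
      ∃ z ∈ Ω, CriticalOver Φ z c ∧
        ∃ ε > 0, ∃ h₀ > 0, ∀ h ∈ H, h < h₀ → ε * h ^ (-μ) ≤ ‖a h z‖

/-- Away from the zero section, the family `A h`, `h ∈ H`, is an elliptic semiclassical Fourier
integral operator of order `μ` with canonical relation `Γ`: it is one microlocally near every point
of `Γ`, and its kernel is `O(h^∞)` microlocally near every other point outside the zero section. -/
structure IsEllipticFIO (H : Set ℝ) (A : ℝ → L2 →L[ℂ] L2) (Γ : Set Phase2) (μ : ℝ) : Prop where
  elliptic : ∀ c ∈ Γ, (c.1.2, c.2.2) ≠ (0, 0) → IsEllipticFIOAt H A Γ μ c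
  negligible : ∀ c, c ∉ Γ → (c.1.2, c.2.2) ≠ (0, 0) → AgreesNear H A 0 c

/-- The map `(x, ξ) ↦ (x + (2 π k / (s |ξ|)) (ξ^⊥ / |ξ|), ξ)`. -/
def shift (s : ℝ) (k : ℤ) (c : Plane × Plane) : Plane × Plane :=
  (c.1 + (2 * Real.pi * k / (s * ‖c.2‖)) • ‖c.2‖⁻¹ • perp c.2, c.2)

/-- The canonical relation given by the graph of `shift s k` on `ξ ≠ 0`. The first component
`(x, Φ_x)` of a point of a canonical relation is the one on the output side of the operator, and the
second component `(y, -Φ_y)` the one on the input side. -/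
def canonicalRelation (s : ℝ) (k : ℤ) : Set Phase2 :=
  {c | c.1.2 ≠ 0 ∧ c.2 = shift s k c.1}

end DirectRecon

end

open DirectRecon

/-!
The reconstruction from `m` angles is the trapezoidal rule for the integral over the circle that
defines the reconstruction from all angles, and the error of the trapezoidal rule consists of
Fourier coefficients of the integrand. These turn out to be the functions `A_k f_ψ`.

On the Fourier side the filter `(4 π)⁻¹ H d/dp` is multiplication by `|σ| / 2` (`ramp_eq`: the
principal value is the limit of a damped sign multiplier). With the Fourier slice theorem
(`fourier_radon`), the filtered data at angle `φ` become `ψ(ω) (I(φ) + I(φ + π)) / 2`, where `I`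
is the integral of `σ 𝓕 f(σ ω) exp (2 π i σ x · ω)` along the ray in the direction `ω = ω(φ)`
(`rayIntegral`, `filteredAt_eq`). In polar coordinates, `∫ exp (2 i n φ) ψ(ω) I(φ) dφ` is the
inverse Fourier transform of `exp (2 i n arg w) ψ(w / |w|) 𝓕 f w` (`integral_polar_schwartz`,
`angularCoeff_eq_fourierInv`). For `n = 0` this is `f_ψ = ψ(D/|D|) f`; for `n = k m` it is `A_k
f_ψ`, since `s h = π / m` turns the phase `2 π k arg ξ / (s h)` into `2 k m arg ξ`
(`angularCoeff_ae_eq_aliasOp`). The filtered data have period `π` in the angle because `ψ` is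
even, so that Poisson summation for `m` equidistant samples (`hasSum_trapezoid`) selects exactly
the coefficients with `n = k m`. Ray integrals can be differentiated in the angle within the class
of ray integrals of Schwartz functions (`exists_hasDerivAt_rayIntegral`); two integrations by
parts bound the coefficients by `C / k ^ 2`, locally uniformly in `x`, and give the unconditional
locally uniform convergence (`hasSumLocallyUniformly_angularCoeff`).

The multipliers have modulus `1`, so the `A_k` are unitary. Since `2 π k / (s h) = 2 k m` is an
integer, `exp (2 π i k arg ξ / (s h))` does not depend on the branch of `arg`, and near a
frequency `ξ₀ ≠ 0` the kernel of `A_k` is an oscillatory integral with amplitude `1` and the phase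
function `(x - y) · θ + (2 π k / s) arg θ`, where `arg` is a smooth branch around `ξ₀`
(`exp_argNear`, `phase`). Its critical set is the graph of `C_k` (`criticalOver_phase_iff`).
Cutting off in `θ` near `ξ₀` costs `O(h^∞)` microlocally, because the localized plane waves are
concentrated at their frequencies (`exists_overlap_le`, `agreesNear_oscKernel`). Off the graph,
either the two frequencies differ, and the same concentration makes the matrix element `O(h^∞)`,
or the phase is not stationary in `θ`, and integration by parts does
(`exists_norm_integral_exp_le`, `agreesNear_zero_aliasOp`).
-/

noncomputable section

open scoped SchwartzMap

namespace DirectRecon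

/-! ### The Fourier transform on `L²` -/

/-- For an integrable and square integrable function the inverse Fourier transform on `L²` is
given by the integral. -/
lemma fourierInv_toLp_ae {F : Plane → ℂ} (h1 : Integrable F) (h2 : MemLp F 2 volume) :
    ((𝓕⁻ h2.toLp : L2) : Plane → ℂ) =ᵐ[volume] 𝓕⁻ F := by
  have hcont : Continuous (𝓕⁻ F) :=
    VectorFourier.fourierIntegral_continuous Real.continuous_fourierChar
      (by simp only [LinearMap.neg_apply, innerₗ_apply_apply]; fun_prop) h1
  refine ae_eq_of_integral_contDiff_smul_eq
    ((Lp.memLp _).locallyIntegrable (by norm_num)) hcont.locallyIntegrable ?_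
  intro g hg hgc
  have hg₁ : HasCompactSupport (Complex.ofRealCLM ∘ g) := hgc.comp_left rfl
  have hg₂ : ContDiff ℝ ∞ (Complex.ofRealCLM ∘ g) := by fun_prop
  set φ := hg₁.toSchwartzMap hg₂ with hφ
  have key := congrArg (fun T => T φ) (Lp.fourierInv_toTemperedDistribution_eq h2.toLp)
  simp only [TemperedDistribution.fourierInv_apply, Lp.toTemperedDistribution_apply] at key
  have e1 : ∫ x, g x • ((𝓕⁻ h2.toLp : L2) : Plane → ℂ) x =
      ∫ x, φ x • ((𝓕⁻ h2.toLp : L2) : Plane → ℂ) x := by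
    congr 1
  have e2 : ∫ x, g x • (𝓕⁻ F) x = ∫ x, φ x • (𝓕⁻ F) x := by
    congr 1
  rw [e1, ← key, e2]
  have e3 : ∫ x, (𝓕⁻ φ : 𝓢(Plane, ℂ)) x • (MemLp.toLp F h2) x = ∫ x, (𝓕⁻ (φ : Plane → ℂ)) x • F x := by
    rw [← SchwartzMap.fourierInv_coe]
    refine integral_congr_ae ?_
    filter_upwards [h2.coeFn_toLp] with x hx
    rw [hx]
  rw [e3]
  have := VectorFourier.integral_fourierIntegral_smul_eq_flip (μ := (volume : Measure Plane))
    (ν := (volume : Measure Plane)) (L := -innerₗ Plane) (f := φ) (g := F)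
    Real.continuous_fourierChar (by simp only [LinearMap.neg_apply, innerₗ_apply_apply]; fun_prop)
    φ.integrable h1
  have hflip : (-innerₗ Plane).flip = -innerₗ Plane := by
    ext x y; simp [real_inner_comm]
  rw [hflip] at this
  exact this

/-- On the Fourier side `aliasOp` is multiplication by the phase factor. -/
lemma fourier_aliasOp (s h : ℝ) (k : ℤ) (g : L2) :
    ((𝓕 (aliasOp s h k g) : L2) : Plane → ℂ) =ᵐ[volume]
      fun w => phaseFactor s h k ((2 * Real.pi * h) • w) * (𝓕 g : L2) w := by
  have : 𝓕 (aliasOp s h k g) = ((ContinuousLinearMap.mul ℂ ℂ).holderL volume ∞ 2 2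
      (memLp_phaseFactor s h k).toLp) (𝓕 g) :=
    (Lp.fourierTransformₗᵢ Plane ℂ).apply_symm_apply _
  rw [this]
  have h1 := ContinuousLinearMap.coeFn_holder (r := 2) (ContinuousLinearMap.mul ℂ ℂ)
    (memLp_phaseFactor s h k).toLp (𝓕 g : L2)
  filter_upwards [h1, (memLp_phaseFactor s h k).coeFn_toLp] with w h1 h2
  refine h1.trans ?_
  rw [h2]
  rfl

lemma norm_phaseFactor (s h : ℝ) (k : ℤ) (ξ : Plane) : ‖phaseFactor s h k ξ‖ = 1 := by
  rw [phaseFactor, mul_comm, Complex.norm_exp_ofReal_mul_I]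

lemma phaseFactor_mul_neg (s h : ℝ) (k : ℤ) (ξ : Plane) :
    phaseFactor s h k ξ * phaseFactor s h (-k) ξ = 1 := by
  rw [phaseFactor, phaseFactor, ← Complex.exp_add, ← Complex.exp_zero]
  congr 1
  push_cast
  ring

lemma aliasOp_aliasOp_neg (s h : ℝ) (k : ℤ) (g : L2) :
    aliasOp s h k (aliasOp s h (-k) g) = g := by
  apply (Lp.fourierTransformₗᵢ Plane ℂ).injective
  apply Lp.ext
  filter_upwards [fourier_aliasOp s h k (aliasOp s h (-k) g), fourier_aliasOp s h (-k) g]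
    with w h1 h2
  refine h1.trans ?_
  rw [h2, ← mul_assoc, phaseFactor_mul_neg, one_mul]
  rfl

lemma norm_aliasOp (s h : ℝ) (k : ℤ) (g : L2) : ‖aliasOp s h k g‖ = ‖g‖ := by
  rw [← Lp.norm_fourier_eq, ← Lp.norm_fourier_eq g]
  rw [Lp.norm_def, Lp.norm_def]
  refine congrArg ENNReal.toReal (eLpNorm_congr_norm_ae ?_)
  filter_upwards [fourier_aliasOp s h k g] with w h1
  rw [h1, norm_mul, norm_phaseFactor, one_mul]

lemma aliasOp_mem_unitary (s h : ℝ) (k : ℤ) : aliasOp s h k ∈ unitary (L2 →L[ℂ] L2) := by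
  let e : L2 ≃ₗᵢ[ℂ] L2 :=
    { (aliasOp s h k : L2 →ₗ[ℂ] L2) with
      invFun := aliasOp s h (-k)
      left_inv := fun g => by simpa using aliasOp_aliasOp_neg s h (-k) g
      right_inv := fun g => aliasOp_aliasOp_neg s h k g
      norm_map' := fun g => norm_aliasOp s h k g }
  exact (Unitary.linearIsometryEquiv.symm e).2

/-! ### Matrix elements of the multipliers -/

/-- A cut-off as a Schwartz function. -/
def Cutoff.schwartz (χ : Cutoff) : 𝓢(Plane, ℂ) := χ.compact.toSchwartzMap χ.smooth

lemma Cutoff.schwartz_apply (χ : Cutoff) (x : Plane) : χ.schwartz x = χ.toFun x := rfl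

lemma Cutoff.contDiff_wave (χ : Cutoff) (ξ : Plane) (h : ℝ) : ContDiff ℝ ∞ (χ.wave ξ h) := by
  have := χ.smooth
  unfold Cutoff.wave
  have h1 : ContDiff ℝ ∞ fun x : Plane => ((inner ℝ x ξ / h : ℝ) : ℂ) :=
    Complex.ofRealCLM.contDiff.comp ((contDiff_id.inner ℝ contDiff_const).div_const h)
  fun_prop

lemma Cutoff.hasCompactSupport_wave (χ : Cutoff) (ξ : Plane) (h : ℝ) :
    HasCompactSupport (χ.wave ξ h) := χ.compact.mul_right

lemma Cutoff.fourier_packet (χ : Cutoff) (ξ : Plane) (h : ℝ) :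
    ((𝓕 (χ.packet ξ h) : L2) : Plane → ℂ) =ᵐ[volume] 𝓕 (χ.wave ξ h) := by
  let φ : 𝓢(Plane, ℂ) := (χ.hasCompactSupport_wave ξ h).toSchwartzMap (χ.contDiff_wave ξ h)
  have h1 : χ.packet ξ h = φ.toLp 2 := rfl
  rw [h1, SchwartzMap.toLp_fourier_eq]
  exact SchwartzMap.coeFn_toLp _ 2 _

lemma Cutoff.fourier_wave (χ : Cutoff) (ξ : Plane) (h : ℝ) (w : Plane) :
    𝓕 (χ.wave ξ h) w = (𝓕 χ.schwartz) (w - (2 * Real.pi * h)⁻¹ • ξ) := by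
  rw [SchwartzMap.fourier_coe, Real.fourier_eq', Real.fourier_eq']
  congr 1
  funext x
  rw [smul_eq_mul, smul_eq_mul, Cutoff.wave, χ.schwartz_apply, mul_left_comm, ← Complex.exp_add,
    mul_comm]
  congr 2
  rw [inner_sub_right, real_inner_smul_right]
  by_cases hh : h = 0
  · simp [hh]
  · have h2 : (h : ℂ) ≠ 0 := by exact_mod_cast hh
    have h3 : (Real.pi : ℂ) ≠ 0 := by exact_mod_cast Real.pi_ne_zero
    push_cast
    field_simp
    ring

lemma inner_packet_aliasOp (χ₁ χ₂ : Cutoff) (ξ η : Plane) (s h : ℝ) (k : ℤ) :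
    inner ℂ (χ₁.packet ξ h) (aliasOp s h k (χ₂.packet η h)) =
      ∫ w, phaseFactor s h k ((2 * Real.pi * h) • w) *
        (starRingEnd ℂ (𝓕 (χ₁.wave ξ h) w) * 𝓕 (χ₂.wave η h) w) := by
  rw [← Lp.inner_fourier_eq, L2.inner_def]
  refine integral_congr_ae ?_
  filter_upwards [fourier_aliasOp s h k (χ₂.packet η h), χ₁.fourier_packet ξ h,
    χ₂.fourier_packet η h] with w h1 h2 h3
  rw [h1, h2, h3, RCLike.inner_apply]
  ring

/-! ### Rapid decay and oscillatory integrals -/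

lemma schwartz_decay (f : 𝓢(Plane, ℂ)) (n : ℕ) :
    ∃ C, 0 ≤ C ∧ ∀ x, (1 + ‖x‖) ^ n * ‖f x‖ ≤ C := by
  have h := SchwartzMap.one_add_le_sup_seminorm_apply (𝕜 := ℂ) (m := (n, 0)) le_rfl le_rfl f
  simp only [norm_iteratedFDeriv_zero] at h
  exact ⟨_, le_trans (by positivity) (h 0), h⟩

lemma integrable_inv_one_add_norm_cube : Integrable fun x : Plane => ((1 + ‖x‖) ^ 3)⁻¹ := by
  have h := integrable_one_add_norm (E := Plane) (μ := volume) (r := 3) (by simp; norm_num)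
  refine h.congr (Eventually.of_forall fun x => ?_)
  have : 0 ≤ 1 + ‖x‖ := by positivity
  change (1 + ‖x‖) ^ (-3 : ℝ) = _
  rw [Real.rpow_neg this]
  norm_cast

/-- Two Schwartz functions centred at the rescaled frequencies `ξ` and `η` have an overlap of size
`O(h^∞)` over the frequencies `θ` that are not close to both `ξ` and `η`. -/
lemma exists_overlap_le (f g : 𝓢(Plane, ℂ)) {r : ℝ} (hr : 0 < r) (N : ℕ) :
    ∃ C, ∀ h > 0, ∀ ξ η : Plane, ∀ c : Plane → ℂ, (∀ θ, ‖c θ‖ ≤ 1) →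
      (∀ θ, ‖θ - ξ‖ + ‖θ - η‖ < r → c θ = 0) →
      ‖∫ w, c ((2 * Real.pi * h) • w) * (starRingEnd ℂ (f (w - (2 * Real.pi * h)⁻¹ • ξ)) *
        g (w - (2 * Real.pi * h)⁻¹ • η))‖ ≤ C * h ^ N := by
  obtain ⟨C₁, hC₁, hf⟩ := schwartz_decay f (N + 3)
  obtain ⟨C₂, hC₂, hg⟩ := schwartz_decay g N
  refine ⟨C₁ * C₂ * (2 * Real.pi / r) ^ N * ∫ x : Plane, ((1 + ‖x‖) ^ 3)⁻¹, ?_⟩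
  intro h hh ξ η c hc hc0
  have hpos : 0 < 2 * Real.pi * h := by positivity
  set ξ' := (2 * Real.pi * h)⁻¹ • ξ with hξ'
  set η' := (2 * Real.pi * h)⁻¹ • η with hη'
  have hint : Integrable fun w : Plane => C₁ * C₂ * (2 * Real.pi / r) ^ N * h ^ N *
      ((1 + ‖w - ξ'‖) ^ 3)⁻¹ :=
    (integrable_inv_one_add_norm_cube.comp_sub_right ξ').const_mul _
  refine (norm_integral_le_of_norm_le hint (Eventually.of_forall fun w => ?_)).trans_eq ?_
  · by_cases hw : ‖(2 * Real.pi * h) • w - ξ‖ + ‖(2 * Real.pi * h) • w - η‖ < r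
    · rw [hc0 _ hw, zero_mul, norm_zero]
      positivity
    · have scale : ∀ ζ : Plane, ‖(2 * Real.pi * h) • w - ζ‖ =
          2 * Real.pi * h * ‖w - (2 * Real.pi * h)⁻¹ • ζ‖ := by
        intro ζ
        rw [← abs_of_pos hpos, ← Real.norm_eq_abs, ← norm_smul, smul_sub, Real.norm_eq_abs,
          abs_of_pos hpos, smul_inv_smul₀ hpos.ne']
      rw [scale, scale, ← mul_add, not_lt, ← hξ', ← hη'] at hw
      set A := ‖w - ξ'‖
      set B := ‖w - η'‖
      have hA : 0 ≤ A := norm_nonneg _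
      have hB : 0 ≤ B := norm_nonneg _
      -- after rescaling, `A + B ≥ r / (2 π h)`: each factor `1 + A` or `1 + B` of decay that is
      -- given up gains a power of `h`
      have h1 : (1 : ℝ) ≤ (2 * Real.pi / r * h) * ((1 + A) * (1 + B)) := by
        have : (1 : ℝ) ≤ (2 * Real.pi * h * (A + B)) / r := by rwa [le_div_iff₀ hr, one_mul]
        have h2 : A + B ≤ (1 + A) * (1 + B) := by nlinarith
        calc (1 : ℝ) ≤ (2 * Real.pi * h * (A + B)) / r := this
          _ = (2 * Real.pi / r * h) * (A + B) := by ring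
          _ ≤ _ := by gcongr
      have h1N := one_le_pow₀ h1 (n := N)
      have hfw := hf (w - ξ')
      have hgw := hg (w - η')
      change (1 + A) ^ (N + 3) * _ ≤ _ at hfw
      change (1 + B) ^ N * _ ≤ _ at hgw
      rw [norm_mul, norm_mul, RCLike.norm_conj]
      calc ‖c ((2 * Real.pi * h) • w)‖ * (‖f (w - ξ')‖ * ‖g (w - η')‖)
          ≤ 1 * (‖f (w - ξ')‖ * ‖g (w - η')‖) := by gcongr; exact hc _
        _ ≤ ((2 * Real.pi / r * h) * ((1 + A) * (1 + B))) ^ N *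
            (‖f (w - ξ')‖ * ‖g (w - η')‖) := by gcongr
        _ = (2 * Real.pi / r) ^ N * h ^ N * ((1 + A) ^ 3)⁻¹ *
            (((1 + A) ^ (N + 3) * ‖f (w - ξ')‖) * ((1 + B) ^ N * ‖g (w - η')‖)) := by
          rw [mul_pow, mul_pow, mul_pow, pow_add]
          field_simp
        _ ≤ (2 * Real.pi / r) ^ N * h ^ N * ((1 + A) ^ 3)⁻¹ * (C₁ * C₂) := by gcongr
        _ = _ := by ring
  · rw [integral_const_mul, integral_sub_right_eq_self (fun w : Plane => ((1 + ‖w‖) ^ 3)⁻¹) ξ']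
    ring

/-- The sesquilinear form of a Fourier multiplier `β`, computed from its kernel. -/
lemma integral_integral_multiplier_kernel {u₁ u₂ β : Plane → ℂ} (h₁ : Integrable u₁)
    (h₂ : Integrable u₂) (hβ : Integrable β) :
    ∫ x, ∫ y, starRingEnd ℂ (u₁ x) *
        (∫ w, Complex.exp (Complex.I * ((2 * Real.pi * inner ℝ (x - y) w : ℝ) : ℂ)) * β w) * u₂ y =
      ∫ w, β w * (starRingEnd ℂ (𝓕 u₁ w) * 𝓕 u₂ w) := by
  have hc : Continuous fun p : Plane × Plane => (innerₗ Plane) p.1 p.2 := by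
    simp only [innerₗ_apply_apply]; fun_prop
  have hF : Continuous (𝓕 u₂) :=
    VectorFourier.fourierIntegral_continuous Real.continuous_fourierChar hc h₂
  have hβF : Integrable fun w => β w * 𝓕 u₂ w :=
    hβ.mul_bdd (c := ∫ v, ‖u₂ v‖) hF.aestronglyMeasurable (Eventually.of_forall fun w =>
      VectorFourier.norm_fourierIntegral_le_integral_norm _ _ _ _ _)
  have inner_int : ∀ x, ∫ y, starRingEnd ℂ (u₁ x) *
        (∫ w, Complex.exp (Complex.I * ((2 * Real.pi * inner ℝ (x - y) w : ℝ) : ℂ)) * β w) * u₂ y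
      = starRingEnd ℂ (u₁ x) * 𝓕⁻ (fun w => β w * 𝓕 u₂ w) x := by
    intro x
    set G : Plane → ℂ := fun w =>
      Complex.exp (Complex.I * ((2 * Real.pi * inner ℝ x w : ℝ) : ℂ)) * β w with hG
    have hGi : Integrable G := by
      refine hβ.bdd_mul (c := 1) ?_ (Eventually.of_forall fun w => ?_)
      · exact Continuous.aestronglyMeasurable (by fun_prop)
      · rw [mul_comm, Complex.norm_exp_ofReal_mul_I]
    have h3 := VectorFourier.integral_fourierIntegral_smul_eq_flip (μ := (volume : Measure Plane))
      (ν := (volume : Measure Plane)) (L := innerₗ Plane) Real.continuous_fourierChar hc hGi h₂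
    rw [flip_innerₗ] at h3
    simp_rw [mul_assoc]
    rw [integral_const_mul]
    congr 1
    rw [Real.fourierInv_eq']
    refine Eq.trans (integral_congr_ae (Eventually.of_forall fun y => ?_)) (h3.trans ?_)
    · simp only [smul_eq_mul]
      congr 1
      change _ = 𝓕 G y
      rw [Real.fourier_eq']
      congr 1
      funext w
      simp only [hG, smul_eq_mul]
      rw [← mul_assoc (Complex.exp _) (Complex.exp _), ← Complex.exp_add]
      congr 2
      rw [inner_sub_left, real_inner_comm y w]
      push_cast
      ring
    · congr 1
      funext w
      rw [hG]
      simp only [smul_eq_mul]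
      rw [real_inner_comm w x]
      change _ * 𝓕 u₂ w = _
      rw [mul_assoc]
      congr 2
      push_cast
      ring
  simp_rw [inner_int]
  have h4 := VectorFourier.integral_sesq_fourierIntegral_eq_neg_flip (μ := (volume : Measure Plane))
      (ν := (volume : Measure Plane)) (L := innerₗ Plane) (innerSL ℂ (E := ℂ))
      Real.continuous_fourierChar hc h₁ hβF
  rw [flip_innerₗ] at h4
  simp only [innerSL_apply_apply, RCLike.inner_apply] at h4
  calc _ = ∫ x, 𝓕⁻ (fun w => β w * 𝓕 u₂ w) x * starRingEnd ℂ (u₁ x) := by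
        simp_rw [mul_comm]
    _ = _ := h4.symm
    _ = _ := by
      congr 1
      funext w
      change _ * starRingEnd ℂ (𝓕 u₁ w) = _
      ring

section NonstationaryPhase

lemma contDiff_of_forall_mem_tsupport {E F : Type*} [NormedAddCommGroup E] [NormedSpace ℝ E]
    [NormedAddCommGroup F] [NormedSpace ℝ F] {g : E → F}
    (hg : ∀ z ∈ tsupport g, ContDiffAt ℝ ∞ g z) : ContDiff ℝ ∞ g := by
  refine contDiff_iff_contDiffAt.2 fun z => ?_
  by_cases hz : z ∈ tsupport g
  · exact hg z hz
  · exact contDiffAt_const.congr_of_eventuallyEq (notMem_tsupport_iff_eventuallyEq.1 hz)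

/-- One integration by parts in a direction `v` in which the phase has no critical points: the
new amplitude is `i` times the derivative of `a / ∂_v Φ` in the direction `v`. -/
lemma exists_integral_exp_eq_mul {Φ : Plane × Plane × Plane → ℝ} {Ω : Set (Plane × Plane × Plane)}
    (hΩ : IsOpen Ω) (hΦ : ContDiffOn ℝ ∞ Φ Ω) (v : Plane)
    (hv : ∀ z ∈ Ω, fderiv ℝ Φ z (0, 0, v) ≠ 0) {a : Plane × Plane × Plane → ℂ}
    (ha : ContDiff ℝ ∞ a) (hac : HasCompactSupport a) (haΩ : tsupport a ⊆ Ω) :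
    ∃ b : Plane × Plane × Plane → ℂ, ContDiff ℝ ∞ b ∧ HasCompactSupport b ∧ tsupport b ⊆ Ω ∧
      ∀ h : ℝ, h ≠ 0 → ∀ x y, ∫ θ, Complex.exp (Complex.I * ((Φ (x, y, θ) / h : ℝ) : ℂ)) *
          a (x, y, θ) =
        h * ∫ θ, Complex.exp (Complex.I * ((Φ (x, y, θ) / h : ℝ) : ℂ)) * b (x, y, θ) := by
  set D : Plane × Plane × Plane → ℝ := fun z => fderiv ℝ Φ z (0, 0, v) with hD
  set q : Plane × Plane × Plane → ℂ := fun z => a z * ((D z)⁻¹ : ℝ) with hq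
  have hqsupp : tsupport q ⊆ tsupport a := tsupport_mul_subset_left
  have hqc : HasCompactSupport q := hac.mul_right
  have hΦat : ∀ z ∈ Ω, ContDiffAt ℝ ∞ Φ z := fun z hz => hΦ.contDiffAt (hΩ.mem_nhds hz)
  have hDat : ∀ z ∈ Ω, ContDiffAt ℝ ∞ D z := fun z hz =>
    ((hΦat z hz).fderiv_right (m := ∞) (by simp)).clm_apply contDiffAt_const
  have hqs : ContDiff ℝ ∞ q := by
    refine contDiff_of_forall_mem_tsupport fun z hz => ?_
    have hzΩ := haΩ (hqsupp hz)
    exact ha.contDiffAt.mul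
      (Complex.ofRealCLM.contDiff.contDiffAt.comp z ((hDat z hzΩ).inv (hv z hzΩ)))
  refine ⟨fun z => Complex.I * fderiv ℝ q z (0, 0, v), ?_, ?_, ?_, ?_⟩
  · exact contDiff_const.mul ((hqs.fderiv_right (m := ∞) (by simp)).clm_apply contDiff_const)
  · exact ((hqc.fderiv_apply ℝ (0, 0, v))).mul_left
  · refine tsupport_mul_subset_right.trans ?_
    exact (tsupport_fderiv_apply_subset ℝ _).trans (hqsupp.trans haΩ)
  intro h hh x y
  set e : Plane × Plane × Plane → ℂ := fun z => Complex.exp (Complex.I * ((Φ z / h : ℝ) : ℂ))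
    with he
  have heat : ∀ z ∈ Ω, ContDiffAt ℝ ∞ e z := fun z hz =>
    Complex.contDiff_exp.contDiffAt.comp z (contDiffAt_const.mul
      (Complex.ofRealCLM.contDiff.contDiffAt.comp z ((hΦat z hz).div_const h)))
  set F : Plane × Plane × Plane → ℂ := fun z => e z * q z with hF
  have hFsupp : tsupport F ⊆ tsupport q := tsupport_mul_subset_right
  have hFs : ContDiff ℝ ∞ F := contDiff_of_forall_mem_tsupport fun z hz =>
    (heat z (haΩ (hqsupp (hFsupp hz)))).mul hqs.contDiffAt
  have hFc : HasCompactSupport F := hqc.mul_left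
  -- the derivative of `F` in the direction `v` is the sum of the two integrands
  have hderiv : ∀ z, fderiv ℝ F z (0, 0, v) =
      Complex.I / h * (e z * a z) + e z * fderiv ℝ q z (0, 0, v) := by
    intro z
    by_cases hz : z ∈ tsupport a
    · have hzΩ := haΩ hz
      have h1 : HasFDerivAt Φ (fderiv ℝ Φ z) z :=
        ((hΦat z hzΩ).differentiableAt (by simp)).hasFDerivAt
      have h2 : HasFDerivAt q (fderiv ℝ q z) z :=
        (hqs.contDiffAt.differentiableAt (by simp)).hasFDerivAt
      have h3 : HasFDerivAt (fun z => ((Φ z / h : ℝ) : ℂ))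
          (Complex.ofRealCLM.comp (h⁻¹ • fderiv ℝ Φ z)) z := by
        have := Complex.ofRealCLM.hasFDerivAt.comp z (h1.const_smul h⁻¹)
        refine this.congr_of_eventuallyEq (Eventually.of_forall fun z => ?_)
        simp [div_eq_inv_mul]
      have h4 := ((h3.const_mul Complex.I).cexp).mul h2
      have h5 : fderiv ℝ F z = _ := h4.fderiv
      rw [h5]
      simp only [add_apply, smul_apply, smul_eq_mul,
        ContinuousLinearMap.comp_apply, Complex.ofRealCLM_apply]
      have hD0 : ((D z : ℝ) : ℂ) ≠ 0 := by exact_mod_cast hv z hzΩ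
      have hh' : (h : ℂ) ≠ 0 := by exact_mod_cast hh
      change e z * fderiv ℝ q z (0, 0, v) + q z * (e z * (Complex.I * ((h⁻¹ * D z : ℝ) : ℂ))) = _
      rw [hq]
      push_cast
      field_simp
      ring
    · have h0 : a z = 0 := image_eq_zero_of_notMem_tsupport hz
      have h1 : fderiv ℝ q z = 0 := by
        by_contra hne
        exact hz (hqsupp (support_fderiv_subset ℝ hne))
      have h2 : fderiv ℝ F z = 0 := by
        by_contra hne
        exact hz (hqsupp (hFsupp (support_fderiv_subset ℝ hne)))
      rw [h0, h1, h2]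
      simp
  have hemb : IsClosedEmbedding fun θ : Plane => ((x, y, θ) : Plane × Plane × Plane) :=
    Function.LeftInverse.isClosedEmbedding (f := fun z => z.2.2) (fun _ => rfl) (by fun_prop)
      (by fun_prop)
  have slice : ∀ g : Plane × Plane × Plane → ℂ, Continuous g → HasCompactSupport g →
      Integrable fun θ => g (x, y, θ) := fun g hg hgc =>
    (hg.comp hemb.continuous).integrable_of_hasCompactSupport (hgc.comp_isClosedEmbedding hemb)
  have hFx : ∀ θ, HasFDerivAt (fun θ => F (x, y, θ)) ((fderiv ℝ F (x, y, θ)).comp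
      ((ContinuousLinearMap.inr ℝ Plane (Plane × Plane)).comp
        (ContinuousLinearMap.inr ℝ Plane Plane))) θ := by
    intro θ
    have h1 : HasFDerivAt F (fderiv ℝ F (x, y, θ)) (x, y, θ) :=
      (hFs.contDiffAt.differentiableAt (by simp)).hasFDerivAt
    exact h1.comp θ ((hasFDerivAt_prodMk_right x (y, θ)).comp θ (hasFDerivAt_prodMk_right y θ))
  have hF'c : Continuous fun z => fderiv ℝ F z (0, 0, v) :=
    (hFs.continuous_fderiv (by simp)).clm_apply continuous_const
  have hF'i := slice _ hF'c (hFc.fderiv_apply ℝ (0, 0, v))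
  have hzero : ∫ θ, fderiv ℝ F (x, y, θ) (0, 0, v) = 0 := by
    have h5 : ∀ θ, fderiv ℝ (fun θ => F (x, y, θ)) θ v = fderiv ℝ F (x, y, θ) (0, 0, v) := by
      intro θ
      rw [(hFx θ).fderiv]
      simp
    have := integral_mul_fderiv_eq_neg_fderiv_mul_of_integrable (𝕜 := ℂ)
      (μ := (volume : Measure Plane)) (f := fun _ : Plane => (1 : ℂ))
      (g := fun θ => F (x, y, θ)) (v := v) (by simp) (by simpa [h5] using hF'i)
      (by simpa using slice _ hFs.continuous hFc) (by fun_prop)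
      (fun θ _ => (hFx θ).differentiableAt)
    simpa [h5] using this
  have hea : Integrable fun θ => e (x, y, θ) * a (x, y, θ) := by
    refine slice (fun z => e z * a z) ?_ hac.mul_left
    exact (contDiff_of_forall_mem_tsupport fun z hz =>
      (heat z (haΩ (tsupport_mul_subset_right hz))).mul ha.contDiffAt).continuous
  have heq : Integrable fun θ => e (x, y, θ) * fderiv ℝ q (x, y, θ) (0, 0, v) := by
    have := hF'i.sub (hea.const_mul (Complex.I / h))
    refine this.congr (Eventually.of_forall fun θ => ?_)
    simp [hderiv]
  simp_rw [hderiv] at hzero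
  rw [integral_add (hea.const_mul _) heq, integral_const_mul] at hzero
  have hh' : (h : ℂ) ≠ 0 := by exact_mod_cast hh
  have h6 : ∫ θ, e (x, y, θ) * (Complex.I * fderiv ℝ q (x, y, θ) (0, 0, v)) =
      Complex.I * ∫ θ, e (x, y, θ) * fderiv ℝ q (x, y, θ) (0, 0, v) := by
    rw [← integral_const_mul]
    congr 1
    funext θ
    ring
  change ∫ θ, e (x, y, θ) * a (x, y, θ) =
    h * ∫ θ, e (x, y, θ) * (Complex.I * fderiv ℝ q (x, y, θ) (0, 0, v))
  rw [h6, eq_neg_of_add_eq_zero_right hzero]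
  field_simp
  rw [Complex.I_sq]
  ring

/-- Nonstationary phase: if the phase has no critical points in some direction of the `θ`-space, the
oscillatory integral is `O(h^∞)`, uniformly in the parameters `x` and `y`. -/
lemma exists_norm_integral_exp_le {Φ : Plane × Plane × Plane → ℝ} {Ω : Set (Plane × Plane × Plane)}
    (hΩ : IsOpen Ω) (hΦ : ContDiffOn ℝ ∞ Φ Ω) (v : Plane)
    (hv : ∀ z ∈ Ω, fderiv ℝ Φ z (0, 0, v) ≠ 0) (N : ℕ) : ∀ {a : Plane × Plane × Plane → ℂ},
    ContDiff ℝ ∞ a → HasCompactSupport a → tsupport a ⊆ Ω →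
    ∃ C, 0 ≤ C ∧ ∀ h > 0, ∀ x y,
      ‖∫ θ, Complex.exp (Complex.I * ((Φ (x, y, θ) / h : ℝ) : ℂ)) * a (x, y, θ)‖ ≤ C * h ^ N := by
  induction N with
  | zero =>
    intro a ha hac _
    obtain ⟨M, hM⟩ := hac.exists_bound_of_continuous ha.continuous
    set S : Set Plane := (fun z : Plane × Plane × Plane => z.2.2) '' tsupport a with hS
    have hSc : IsCompact S := hac.isCompact.image (by fun_prop)
    have hint : Integrable (S.indicator fun _ => M) :=
      (integrable_indicator_iff hSc.measurableSet).2
        (integrableOn_const hSc.measure_lt_top.ne)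
    have hM0 : 0 ≤ M := (norm_nonneg _).trans (hM 0)
    refine ⟨∫ θ, S.indicator (fun _ => M) θ, integral_nonneg fun θ =>
      Set.indicator_nonneg (fun _ _ => hM0) θ, fun h _ x y => ?_⟩
    rw [pow_zero, mul_one]
    refine norm_integral_le_of_norm_le hint (Eventually.of_forall fun θ => ?_)
    rw [norm_mul, mul_comm Complex.I, Complex.norm_exp_ofReal_mul_I, one_mul]
    by_cases hθ : θ ∈ S
    · rw [Set.indicator_of_mem hθ]
      exact hM _
    · have : a (x, y, θ) = 0 := by
        by_contra hne
        exact hθ ⟨(x, y, θ), subset_tsupport _ hne, rfl⟩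
      rw [this, norm_zero]
      exact Set.indicator_nonneg (fun _ _ => hM0) θ
  | succ N ih =>
    intro a ha hac haΩ
    obtain ⟨b, hb, hbc, hbΩ, hab⟩ := exists_integral_exp_eq_mul hΩ hΦ v hv ha hac haΩ
    obtain ⟨C, hC, h1⟩ := ih hb hbc hbΩ
    refine ⟨C, hC, fun h hh x y => ?_⟩
    rw [hab h hh.ne' x y, norm_mul, Complex.norm_real, Real.norm_of_nonneg hh.le, pow_succ]
    calc _ ≤ h * (C * h ^ N) := by gcongr; exact h1 h hh x y
      _ = _ := by ring

end NonstationaryPhase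

/-! ### A phase function for the multipliers -/

/-- The identification of the plane with `ℂ`. -/
def toComplex : Plane →L[ℝ] ℂ := (Complex.orthonormalBasisOneI.repr.symm : Plane →L[ℝ] ℂ)

lemma toComplex_apply (ξ : Plane) : toComplex ξ = ⟨ξ 0, ξ 1⟩ := by
  change Complex.orthonormalBasisOneI.repr.symm ξ = _
  rw [LinearIsometryEquiv.symm_apply_eq]
  ext i
  fin_cases i <;> simp

lemma norm_toComplex (ξ : Plane) : ‖toComplex ξ‖ = ‖ξ‖ :=
  Complex.orthonormalBasisOneI.repr.symm.norm_map ξ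

lemma toComplex_ne_zero {ξ : Plane} (hξ : ξ ≠ 0) : toComplex ξ ≠ 0 := by
  rw [← norm_ne_zero_iff, norm_toComplex]
  exact norm_ne_zero_iff.2 hξ

lemma inner_eq (x y : Plane) : inner ℝ x y = x 0 * y 0 + x 1 * y 1 := by
  rw [PiLp.inner_apply, Fin.sum_univ_two]
  simp [mul_comm]

lemma perp_zero_coord (ξ : Plane) : perp ξ 0 = -ξ 1 := rfl

lemma perp_one_coord (ξ : Plane) : perp ξ 1 = ξ 0 := rfl

/-- The branch of the polar angle that is smooth on the half plane around `ξ₀` and agrees with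
`arg` at `ξ₀`. -/
def argNear (ξ₀ ξ : Plane) : ℝ :=
  arg ξ₀ + (Complex.log (toComplex ξ * starRingEnd ℂ (toComplex ξ₀))).im

lemma mul_conj_mem_slitPlane {ξ₀ ξ : Plane} (hξ : 0 < inner ℝ ξ ξ₀) :
    toComplex ξ * starRingEnd ℂ (toComplex ξ₀) ∈ Complex.slitPlane := by
  refine Or.inl ?_
  rw [inner_eq] at hξ
  simpa [toComplex_apply] using hξ

lemma contDiffAt_argNear {ξ₀ ξ : Plane} (hξ : 0 < inner ℝ ξ ξ₀) :
    ContDiffAt ℝ ∞ (argNear ξ₀) ξ := by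
  have h1 : ContDiffAt ℝ ∞ Complex.log (toComplex ξ * starRingEnd ℂ (toComplex ξ₀)) :=
    (Complex.contDiffAt_log (mul_conj_mem_slitPlane hξ)).restrict_scalars ℝ
  have h2 : ContDiffAt ℝ ∞ (fun ξ => toComplex ξ * starRingEnd ℂ (toComplex ξ₀)) ξ :=
    (toComplex.contDiff.mul contDiff_const).contDiffAt
  have h3 : ContDiffAt ℝ ∞
      (fun ξ => (Complex.log (toComplex ξ * starRingEnd ℂ (toComplex ξ₀))).im) ξ :=
    Complex.imCLM.contDiff.contDiffAt.comp ξ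
      (ContDiffAt.comp ξ (g := Complex.log)
        (f := fun ξ => toComplex ξ * starRingEnd ℂ (toComplex ξ₀)) h1 h2)
  exact contDiffAt_const.add h3

lemma hasFDerivAt_argNear {ξ₀ ξ : Plane} (hξ : 0 < inner ℝ ξ ξ₀) :
    HasFDerivAt (argNear ξ₀) ((‖ξ‖ ^ 2)⁻¹ • innerSL ℝ (perp ξ)) ξ := by
  have h0 : ξ₀ ≠ 0 := by rintro rfl; simp at hξ
  have h0' : ξ ≠ 0 := by rintro rfl; simp at hξ
  have h1 : HasFDerivAt (𝕜 := ℝ) (fun ξ => toComplex ξ * starRingEnd ℂ (toComplex ξ₀)) _ ξ :=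
    toComplex.hasFDerivAt.mul_const _
  have h2 := ((Complex.hasStrictDerivAt_log (mul_conj_mem_slitPlane
    hξ)).hasDerivAt.hasFDerivAt.restrictScalars ℝ).comp ξ h1
  have h3 := (Complex.imCLM.hasFDerivAt.comp ξ h2).const_add (arg ξ₀)
  refine (show HasFDerivAt (argNear ξ₀) _ ξ from h3).congr_fderiv ?_
  ext τ
  have hz : starRingEnd ℂ (toComplex ξ₀) ≠ 0 := by
    simpa using toComplex_ne_zero h0
  have hz' := toComplex_ne_zero h0'
  have hn : ‖ξ‖ ^ 2 = ξ 0 ^ 2 + ξ 1 ^ 2 := by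
    rw [EuclideanSpace.norm_sq_eq, Fin.sum_univ_two]; simp
  have key : (starRingEnd ℂ (toComplex ξ₀) * toComplex τ) *
      (toComplex ξ * starRingEnd ℂ (toComplex ξ₀))⁻¹ = toComplex τ / toComplex ξ := by
    field_simp
  simp only [ContinuousLinearMap.comp_apply, smul_apply, smul_eq_mul,
    ContinuousLinearMap.coe_restrictScalars', ContinuousLinearMap.toSpanSingleton_apply,
    Complex.imCLM_apply, innerSL_apply_apply, inner_eq, perp_zero_coord, perp_one_coord, hn]
  rw [key, Complex.div_im, toComplex_apply, toComplex_apply, Complex.normSq_apply]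
  simp only [← pow_two]
  ring

/-- At the admissible values of `h` the choice of the branch of the angle is immaterial. -/
lemma exp_argNear {s h : ℝ} (hs : 0 < s) (hh : h ∈ admissible s) (k : ℤ) {ξ₀ ξ : Plane}
    (h₀ : ξ₀ ≠ 0) (h₁ : ξ ≠ 0) :
    Complex.exp (Complex.I * ((2 * Real.pi * k / s * argNear ξ₀ ξ / h : ℝ) : ℂ)) =
      phaseFactor s h k ξ := by
  obtain ⟨m, hm, rfl⟩ := hh
  have hm' : (m : ℝ) ≠ 0 := by positivity
  have hpi := Real.pi_ne_zero
  have e1 : ∀ t : ℝ, Complex.exp (Complex.I * ((2 * k * m * t : ℝ) : ℂ)) =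
      Complex.exp (t * Complex.I) ^ (2 * k * m) := by
    intro t
    rw [← Complex.exp_int_mul]
    congr 1
    push_cast
    ring
  have e2 : 2 * Real.pi * k / s * argNear ξ₀ ξ / (Real.pi / (s * m)) =
      2 * k * m * argNear ξ₀ ξ := by field_simp
  have e3 : 2 * Real.pi * k * arg ξ / (s * (Real.pi / (s * m))) = 2 * k * m * arg ξ := by
    field_simp
  rw [phaseFactor, e2, e3, e1, e1]
  congr 1
  have hz := toComplex_ne_zero h₀
  have hw := toComplex_ne_zero h₁
  have a0 : (‖toComplex ξ₀‖ : ℂ) * Complex.exp (arg ξ₀ * Complex.I) = toComplex ξ₀ := by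
    rw [arg, ← toComplex_apply]; exact Complex.norm_mul_exp_arg_mul_I _
  have a1 : (‖toComplex ξ‖ : ℂ) * Complex.exp (arg ξ * Complex.I) = toComplex ξ := by
    rw [arg, ← toComplex_apply]; exact Complex.norm_mul_exp_arg_mul_I _
  have a2 := Complex.norm_mul_exp_arg_mul_I (toComplex ξ * starRingEnd ℂ (toComplex ξ₀))
  rw [argNear, Complex.log_im, Complex.ofReal_add, add_mul, Complex.exp_add]
  rw [norm_mul, RCLike.norm_conj] at a2
  have n0 : (‖toComplex ξ₀‖ : ℂ) ≠ 0 := by simpa using hz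
  have n1 : (‖toComplex ξ‖ : ℂ) ≠ 0 := by simpa using hw
  have a3 : toComplex ξ₀ * starRingEnd ℂ (toComplex ξ₀) = (‖toComplex ξ₀‖ : ℂ) ^ 2 :=
    Complex.mul_conj' _
  apply mul_left_cancel₀ (mul_ne_zero (pow_ne_zero 2 n0) n1)
  push_cast at a2
  calc _ = (‖toComplex ξ₀‖ * Complex.exp (arg ξ₀ * Complex.I)) *
        (‖toComplex ξ‖ * ‖toComplex ξ₀‖ * Complex.exp (Complex.arg
          (toComplex ξ * starRingEnd ℂ (toComplex ξ₀)) * Complex.I)) := by ring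
    _ = ‖toComplex ξ₀‖ ^ 2 * toComplex ξ := by rw [a0, a2, ← a3]; ring
    _ = ‖toComplex ξ₀‖ ^ 2 * (‖toComplex ξ‖ * Complex.exp (arg ξ * Complex.I)) := by rw [a1]
    _ = _ := by ring

/-- The phase function `(x - y) · θ + κ arg θ`, with the branch of `arg` around `ξ₀`. -/
def phase (κ : ℝ) (ξ₀ : Plane) (z : Plane × Plane × Plane) : ℝ :=
  inner ℝ (z.1 - z.2.1) z.2.2 + κ * argNear ξ₀ z.2.2

/-- The set of points `(x, y, θ)` with `θ` in the open half plane around `ξ₀`. -/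
def phaseDomain (ξ₀ : Plane) : Set (Plane × Plane × Plane) := {z | 0 < inner ℝ z.2.2 ξ₀}

lemma isOpen_phaseDomain (ξ₀ : Plane) : IsOpen (phaseDomain ξ₀) :=
  isOpen_lt continuous_const (by fun_prop)

lemma contDiffOn_phase (κ : ℝ) (ξ₀ : Plane) : ContDiffOn ℝ ∞ (phase κ ξ₀) (phaseDomain ξ₀) := by
  intro z hz
  have h1 : ContDiffAt ℝ ∞ (fun z : Plane × Plane × Plane => argNear ξ₀ z.2.2) z :=
    ContDiffAt.comp z (g := argNear ξ₀) (f := fun z : Plane × Plane × Plane => z.2.2)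
      (contDiffAt_argNear hz) (by fun_prop)
  refine ContDiffAt.contDiffWithinAt (ContDiffAt.add ?_ (contDiffAt_const.mul h1))
  exact ContDiffAt.inner ℝ (by fun_prop) (by fun_prop)

lemma fderiv_phase (κ : ℝ) {ξ₀ : Plane} {z : Plane × Plane × Plane} (hz : z ∈ phaseDomain ξ₀)
    (v u τ : Plane) : fderiv ℝ (phase κ ξ₀) z (v, u, τ) =
      inner ℝ (v - u) z.2.2 + inner ℝ (z.1 - z.2.1) τ +
        κ * ((‖z.2.2‖ ^ 2)⁻¹ * inner ℝ (perp z.2.2) τ) := by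
  have h2 : HasFDerivAt (fun z : Plane × Plane × Plane => z.2.2) _ z :=
    ((ContinuousLinearMap.snd ℝ Plane Plane).comp
      (ContinuousLinearMap.snd ℝ Plane (Plane × Plane))).hasFDerivAt
  have h1 : HasFDerivAt (fun z : Plane × Plane × Plane => z.1 - z.2.1) _ z :=
    hasFDerivAt_fst.sub
      ((ContinuousLinearMap.fst ℝ Plane Plane).comp
        (ContinuousLinearMap.snd ℝ Plane (Plane × Plane))).hasFDerivAt
  have h3 := (h1.inner ℝ h2).add (((hasFDerivAt_argNear hz).comp z h2).const_mul κ)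
  rw [(show HasFDerivAt (phase κ ξ₀) _ z from h3).fderiv]
  simp [fderivInnerCLM_apply, inner_sub_left]
  ring

lemma criticalOver_phase_iff (κ : ℝ) {ξ₀ : Plane} {z : Plane × Plane × Plane}
    (hz : z ∈ phaseDomain ξ₀) (c : Phase2) :
    CriticalOver (N := 2) (phase κ ξ₀) z c ↔
      c = ((z.1, z.2.2), (z.2.1, z.2.2)) ∧ z.2.1 = z.1 + (κ * (‖z.2.2‖ ^ 2)⁻¹) • perp z.2.2 := by
  constructor
  · rintro ⟨h1, h2, h3, h4, h5⟩
    have hl : c.1.2 = z.2.2 := by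
      refine ext_inner_right ℝ fun v => ?_
      rw [← h3, fderiv_phase κ hz]
      simp [real_inner_comm]
    have hr : c.2.2 = z.2.2 := by
      refine ext_inner_right ℝ fun v => ?_
      rw [← neg_eq_iff_eq_neg.2 (h5 v), fderiv_phase κ hz]
      simp [real_inner_comm]
    refine ⟨Prod.ext (Prod.ext h2 hl) (Prod.ext h4 hr), ?_⟩
    refine ext_inner_right ℝ fun τ => ?_
    have := h1 τ
    rw [fderiv_phase κ hz] at this
    simp only [sub_self, inner_zero_left, zero_add, inner_sub_left] at this
    rw [inner_add_left, real_inner_smul_left]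
    linarith
  · rintro ⟨rfl, h⟩
    refine ⟨fun τ => ?_, rfl, fun v => ?_, rfl, fun v => ?_⟩
    · rw [fderiv_phase κ hz, h]
      simp [real_inner_smul_left]
      ring
    · rw [fderiv_phase κ hz]
      simp [real_inner_comm]
    · rw [fderiv_phase κ hz]
      simp [real_inner_comm]

lemma mem_canonicalRelation_iff (s : ℝ) (k : ℤ) (c : Phase2) : c ∈ canonicalRelation s k ↔
    c.1.2 ≠ 0 ∧ c.2.2 = c.1.2 ∧
      c.2.1 = c.1.1 + (2 * Real.pi * k / s * (‖c.1.2‖ ^ 2)⁻¹) • perp c.1.2 := by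
  have : (2 * Real.pi * k / (s * ‖c.1.2‖)) • ‖c.1.2‖⁻¹ • perp c.1.2 =
      (2 * Real.pi * k / s * (‖c.1.2‖ ^ 2)⁻¹) • perp c.1.2 := by
    rw [smul_smul]
    congr 1
    ring
  rw [canonicalRelation, Set.mem_ofPred_eq, shift, this, Prod.ext_iff]
  tauto

lemma parametrizes_phase {s : ℝ} {k : ℤ} {c : Phase2} (hc : c ∈ canonicalRelation s k) :
    Parametrizes (N := 2) (phase (2 * Real.pi * k / s) c.1.2) (phaseDomain c.1.2)
      (canonicalRelation s k) c where
  isOpen := isOpen_phaseDomain _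
  smooth := contDiffOn_phase _ _
  nondegenerate := by
    intro z hz _ τ hτ
    set κ := 2 * Real.pi * k / s
    set g : Plane × Plane × Plane → ℝ := fun z' => fderiv ℝ (phase κ c.1.2) z' (0, 0, τ) with hg
    have hgd : DifferentiableAt ℝ g z :=
      ((((contDiffOn_phase κ c.1.2).contDiffAt ((isOpen_phaseDomain _).mem_nhds hz)).fderiv_right
        (m := ∞) (by simp)).clm_apply contDiffAt_const).differentiableAt (by simp)
    -- differentiate along the line on which only `x` moves, in the direction `τ`
    have hline : HasDerivAt (fun t : ℝ => z + t • ((τ, 0, 0) : Plane × Plane × Plane))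
        (τ, 0, 0) 0 := by
      simpa using ((hasDerivAt_id (0 : ℝ)).smul_const ((τ, 0, 0) : Plane × Plane × Plane)).const_add z
    have h1 : HasDerivAt (fun t : ℝ => g (z + t • ((τ, 0, 0) : Plane × Plane × Plane))) 0 0 := by
      have hgd' : HasFDerivAt (𝕜 := ℝ) g 0 (z + (0 : ℝ) • ((τ, 0, 0) : Plane × Plane × Plane)) := by
        have := hgd.hasFDerivAt
        rw [show fderiv ℝ g z = 0 from hτ] at this
        simpa using this
      have := HasFDerivAt.comp_hasDerivAt (𝕜 := ℝ) (l := g) (l' := 0)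
        (f := fun t : ℝ => z + t • ((τ, 0, 0) : Plane × Plane × Plane)) (0 : ℝ) hgd' hline
      exact this
    have h2 : ∀ t : ℝ, g (z + t • ((τ, 0, 0) : Plane × Plane × Plane)) =
        t * inner ℝ τ τ + g z := by
      intro t
      have hz' : z + t • ((τ, 0, 0) : Plane × Plane × Plane) ∈ phaseDomain c.1.2 := by
        simpa [phaseDomain] using hz
      rw [hg]
      simp only
      rw [fderiv_phase κ hz', fderiv_phase κ hz]
      simp only [Prod.fst_add, Prod.snd_add, Prod.smul_fst, Prod.smul_snd, smul_zero, add_zero,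
        inner_sub_left, inner_add_left, real_inner_smul_left]
      ring
    simp_rw [h2] at h1
    have h3 : HasDerivAt (fun t : ℝ => t * inner ℝ τ τ + g z) (inner ℝ τ τ) 0 := by
      simpa using ((hasDerivAt_id (0 : ℝ)).mul_const (inner ℝ τ τ)).add_const (g z)
    exact inner_self_eq_zero.1 (h3.unique h1)
  mem := by
    intro z hz c' hc'
    obtain ⟨rfl, h⟩ := (criticalOver_phase_iff _ hz _).1 hc'
    refine (mem_canonicalRelation_iff _ _ _).2 ⟨?_, rfl, h⟩
    intro h0
    simp only [phaseDomain, Set.mem_ofPred_eq] at hz h0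
    simp [h0] at hz
  covers := by
    refine ⟨{c' | 0 < inner ℝ c'.1.2 c.1.2}, isOpen_lt continuous_const (by fun_prop), ?_, ?_⟩
    · exact real_inner_self_pos.2 hc.1
    · rintro c' ⟨h1, h2⟩
      obtain ⟨-, h3, h4⟩ := (mem_canonicalRelation_iff _ _ _).1 h1
      refine ⟨(c'.1.1, c'.2.1, c'.1.2), h2, (criticalOver_phase_iff _ h2 _).2 ⟨?_, h4⟩⟩
      exact Prod.ext rfl (Prod.ext rfl h3)
  injective := by
    intro z hz z' hz' c' h h'
    obtain ⟨e, -⟩ := (criticalOver_phase_iff _ hz _).1 h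
    obtain ⟨e', -⟩ := (criticalOver_phase_iff _ hz' _).1 h'
    have := e.symm.trans e'
    simp only [Prod.mk.injEq] at this
    exact Prod.ext this.1.1 (Prod.ext this.2.1 this.1.2)

/-! ### The multipliers are Fourier integral operators -/

/-- A smooth bump around `c`, equal to `1` on the ball of radius `r`, with support in the ball of
radius `2 r`. -/
def bump (c : Plane) {r : ℝ} (hr : 0 < r) : ContDiffBump c := ⟨r, 2 * r, hr, by linarith⟩

/-- The bump around `c` as a cut-off. -/
def bumpCutoff (c : Plane) {r : ℝ} (hr : 0 < r) : Cutoff where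
  toFun x := (bump c hr x : ℂ)
  smooth := Complex.ofRealCLM.contDiff.comp (bump c hr).contDiff
  compact := (bump c hr).hasCompactSupport.comp_left Complex.ofReal_zero

lemma bumpCutoff_self (c : Plane) {r : ℝ} (hr : 0 < r) : (bumpCutoff c hr).toFun c ≠ 0 := by
  have : bump c hr c = 1 := (bump c hr).one_of_mem_closedBall (Metric.mem_closedBall_self hr.le)
  simp [bumpCutoff, this]

lemma two_mul_pos {r : ℝ} (hr : 0 < r) : 0 < 2 * r := by linarith

/-- The amplitude: a product of bumps around the components of `z₀`. The first two are equal to `1`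
on the supports of the cut-offs `bumpCutoff z₀.1 hr` and `bumpCutoff z₀.2.1 hr`. -/
def amplitude (z₀ : Plane × Plane × Plane) {r : ℝ} (hr : 0 < r) (z : Plane × Plane × Plane) : ℂ :=
  (bump z₀.1 (two_mul_pos hr) z.1 * bump z₀.2.1 (two_mul_pos hr) z.2.1 * bump z₀.2.2 hr z.2.2 : ℝ)

lemma contDiff_amplitude (z₀ : Plane × Plane × Plane) {r : ℝ} (hr : 0 < r) :
    ContDiff ℝ ∞ (amplitude z₀ hr) :=
  Complex.ofRealCLM.contDiff.comp
    ((((bump z₀.1 (two_mul_pos hr)).contDiff.comp contDiff_fst).mul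
      ((bump z₀.2.1 (two_mul_pos hr)).contDiff.comp (contDiff_fst.comp contDiff_snd))).mul
      ((bump z₀.2.2 hr).contDiff.comp (contDiff_snd.comp contDiff_snd)))

lemma dist_lt_of_bump_ne_zero {c x : Plane} {r : ℝ} {hr : 0 < r} (h : bump c hr x ≠ 0) :
    dist x c < 2 * r := by
  have : x ∈ Function.support (bump c hr) := h
  rwa [(bump c hr).support_eq] at this

lemma tsupport_amplitude (z₀ : Plane × Plane × Plane) {r : ℝ} (hr : 0 < r) :
    tsupport (amplitude z₀ hr) ⊆ Metric.closedBall z₀ (4 * r) := by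
  refine closure_minimal (fun z hz => ?_) Metric.isClosed_closedBall
  have hz' : bump z₀.1 (two_mul_pos hr) z.1 * bump z₀.2.1 (two_mul_pos hr) z.2.1 *
      bump z₀.2.2 hr z.2.2 ≠ 0 := fun h => hz (by simp [amplitude, h])
  have h1 := dist_lt_of_bump_ne_zero (left_ne_zero_of_mul (left_ne_zero_of_mul hz'))
  have h2 := dist_lt_of_bump_ne_zero (right_ne_zero_of_mul (left_ne_zero_of_mul hz'))
  have h3 := dist_lt_of_bump_ne_zero (right_ne_zero_of_mul hz')
  rw [Metric.mem_closedBall, Prod.dist_eq, Prod.dist_eq]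
  refine max_le ?_ (max_le ?_ ?_) <;> linarith

lemma hasCompactSupport_amplitude (z₀ : Plane × Plane × Plane) {r : ℝ} (hr : 0 < r) :
    HasCompactSupport (amplitude z₀ hr) :=
  (isCompact_closedBall z₀ (4 * r)).of_isClosed_subset (isClosed_tsupport _)
    (tsupport_amplitude z₀ hr)

lemma admissible_pos {s h : ℝ} (hs : 0 < s) (hh : h ∈ admissible s) : 0 < h := by
  obtain ⟨m, hm, rfl⟩ := hh
  have : (0 : ℝ) < m := by exact_mod_cast hm
  have := Real.pi_pos
  positivity

lemma oscKernel_eq (Φ : Plane × Plane × Plane → ℝ) (a : ℝ → Plane × Plane × Plane → ℂ) {h : ℝ}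
    (hh : 0 < h) (x y : Plane) : oscKernel (N := 2) Φ a h x y =
      (((2 * Real.pi * h) ^ 2)⁻¹ : ℝ) *
        ∫ θ, Complex.exp (Complex.I * ((Φ (x, y, θ) / h : ℝ) : ℂ)) * a h (x, y, θ) := by
  have hpos : 0 < 2 * Real.pi * h := by positivity
  rw [oscKernel]
  congr 2
  rw [← Real.rpow_natCast, ← Real.rpow_neg hpos.le]
  norm_num

/-- The oscillatory integral with the phase function `phase`, cut off in the `x` and `y` variables,
is a truncation of the multiplier to the frequencies around `ξ₀`. -/
lemma integral_integral_oscKernel {s h : ℝ} (hs : 0 < s) (hh : h ∈ admissible s) (k : ℤ)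
    {z₀ : Plane × Plane × Plane} {r : ℝ} (hr : 0 < r) (hz₀ : z₀.2.2 ≠ 0)
    (hball : Metric.closedBall z₀ (4 * r) ⊆ phaseDomain z₀.2.2) (ξ η : Plane) :
    ∫ x, ∫ y, starRingEnd ℂ ((bumpCutoff z₀.1 hr).wave ξ h x) *
        oscKernel (N := 2) (phase (2 * Real.pi * k / s) z₀.2.2) (fun _ => amplitude z₀ hr) h x y *
          (bumpCutoff z₀.2.1 hr).wave η h y =
      ∫ w, ((bump z₀.2.2 hr ((2 * Real.pi * h) • w) : ℂ) *
          phaseFactor s h k ((2 * Real.pi * h) • w)) *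
        (starRingEnd ℂ (𝓕 ((bumpCutoff z₀.1 hr).wave ξ h) w) *
          𝓕 ((bumpCutoff z₀.2.1 hr).wave η h) w) := by
  have hpos := admissible_pos hs hh
  have hpos' : 0 < 2 * Real.pi * h := by positivity
  have hint : ∀ (χ : Cutoff) (ζ : Plane), Integrable (χ.wave ζ h) := fun χ ζ =>
    (χ.contDiff_wave ζ h).continuous.integrable_of_hasCompactSupport (χ.hasCompactSupport_wave ζ h)
  have hβ : Integrable fun w : Plane => (bump z₀.2.2 hr ((2 * Real.pi * h) • w) : ℂ) *
      phaseFactor s h k ((2 * Real.pi * h) • w) := by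
    have h1 : Integrable fun θ : Plane => (bump z₀.2.2 hr θ : ℂ) * phaseFactor s h k θ := by
      refine Integrable.mul_bdd (c := 1) ?_
        (measurable_phaseFactor s h k).aestronglyMeasurable
        (Eventually.of_forall fun θ => (norm_phaseFactor s h k θ).le)
      exact (bumpCutoff z₀.2.2 hr).smooth.continuous.integrable_of_hasCompactSupport
        (bumpCutoff z₀.2.2 hr).compact
    exact h1.comp_smul hpos'.ne'
  rw [← integral_integral_multiplier_kernel (hint _ ξ) (hint _ η) hβ]
  congr 1
  funext x
  congr 1
  funext y
  by_cases hx : (bumpCutoff z₀.1 hr).toFun x = 0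
  · simp [Cutoff.wave, hx]
  by_cases hy : (bumpCutoff z₀.2.1 hr).toFun y = 0
  · simp [Cutoff.wave, hy]
  congr 2
  have hx1 : dist x z₀.1 < 2 * r := dist_lt_of_bump_ne_zero (hr := hr) fun h => hx (by
    simp [bumpCutoff, h])
  have hy1 : dist y z₀.2.1 < 2 * r := dist_lt_of_bump_ne_zero (hr := hr) fun h => hy (by
    simp [bumpCutoff, h])
  have hbx : bump z₀.1 (two_mul_pos hr) x = 1 := ContDiffBump.one_of_mem_closedBall _ hx1.le
  have hby : bump z₀.2.1 (two_mul_pos hr) y = 1 := ContDiffBump.one_of_mem_closedBall _ hy1.le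
  rw [oscKernel_eq _ _ hpos]
  -- the substitution `θ = 2 π h w` absorbs the prefactor `(2 π h)⁻²`
  have hscale := Measure.integral_comp_smul (volume : Measure Plane)
    (fun θ : Plane => Complex.exp (Complex.I * ((inner ℝ (x - y) θ / h : ℝ) : ℂ)) *
      ((bump z₀.2.2 hr θ : ℂ) * phaseFactor s h k θ)) (2 * Real.pi * h)
  have e1 : ∀ w : Plane, inner ℝ (x - y) ((2 * Real.pi * h) • w) / h =
      2 * Real.pi * inner ℝ (x - y) w := by
    intro w
    rw [real_inner_smul_right]
    field_simp
  simp only [e1, finrank_euclideanSpace, Fintype.card_fin] at hscale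
  rw [hscale, abs_of_pos (by positivity), Complex.real_smul]
  congr 2
  funext θ
  by_cases hθ : bump z₀.2.2 hr θ = 0
  · simp [amplitude, hθ]
  have hθ1 : dist θ z₀.2.2 < 2 * r := dist_lt_of_bump_ne_zero hθ
  have hmem : ((z₀.1, z₀.2.1, θ) : Plane × Plane × Plane) ∈ phaseDomain z₀.2.2 := by
    refine hball ?_
    rw [Metric.mem_closedBall, Prod.dist_eq, Prod.dist_eq]
    simp only [dist_self]
    refine max_le ?_ (max_le ?_ ?_) <;> linarith
  have hθ0 : θ ≠ 0 := by
    rintro rfl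
    simp [phaseDomain] at hmem
  rw [← exp_argNear hs hh k hz₀ hθ0, amplitude, hbx, hby, one_mul, one_mul, mul_left_comm,
    ← Complex.exp_add, mul_comm]
  congr 2
  rw [← mul_add, ← Complex.ofReal_add, ← add_div]
  rfl

/-- Near a point over the diagonal of frequencies, the multiplier is the oscillatory integral, up to
the part of the multiplier at a distance from the frequency `ξ₀`. -/
lemma agreesNear_oscKernel {s : ℝ} (hs : 0 < s) (k : ℤ)
    {z₀ : Plane × Plane × Plane} {r : ℝ} (hr : 0 < r) (hz₀ : z₀.2.2 ≠ 0)
    (hball : Metric.closedBall z₀ (4 * r) ⊆ phaseDomain z₀.2.2) :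
    AgreesNear (admissible s) (fun h => aliasOp s h k)
      (oscKernel (N := 2) (phase (2 * Real.pi * k / s) z₀.2.2) (fun _ => amplitude z₀ hr))
      ((z₀.1, z₀.2.2), (z₀.2.1, z₀.2.2)) := by
  refine ⟨bumpCutoff z₀.1 hr, bumpCutoff z₀.2.1 hr, bumpCutoff_self _ hr, bumpCutoff_self _ hr,
    Metric.ball z₀.2.2 (r / 2) ×ˢ Set.univ,
    prod_mem_nhds (Metric.ball_mem_nhds _ (by positivity)) univ_mem, fun N => ?_⟩
  obtain ⟨C, hC⟩ := exists_overlap_le (𝓕 (bumpCutoff z₀.1 hr).schwartz)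
    (𝓕 (bumpCutoff z₀.2.1 hr).schwartz) (half_pos hr) N
  refine ⟨C, 1, one_pos, fun h hh _ v hv => ?_⟩
  have hpos := admissible_pos hs hh
  have hpos' : 0 < 2 * Real.pi * h := by positivity
  rw [integral_integral_oscKernel hs hh k hr hz₀ hball, inner_packet_aliasOp, ← integral_sub]
  · have := hC h hpos v.1 v.2
      (fun θ => (1 - (bump z₀.2.2 hr θ : ℂ)) * phaseFactor s h k θ) (fun θ => ?_) (fun θ hθ => ?_)
    · refine le_trans (le_of_eq ?_) this
      congr 2
      funext w
      rw [Cutoff.fourier_wave, Cutoff.fourier_wave]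
      ring
    · rw [norm_mul, norm_phaseFactor, mul_one, ← Complex.ofReal_one, ← Complex.ofReal_sub,
        Complex.norm_real, Real.norm_of_nonneg (sub_nonneg.2 (bump z₀.2.2 hr).le_one)]
      linarith [(bump z₀.2.2 hr).nonneg (x := θ)]
    · have h1 : dist θ z₀.2.2 ≤ r := by
        have h2 : dist v.1 z₀.2.2 < r / 2 := hv.1
        have h3 : dist θ v.1 < r / 2 := by
          rw [dist_eq_norm]; linarith [norm_nonneg (θ - v.2)]
        linarith [dist_triangle θ v.1 z₀.2.2]
      have h4 : bump z₀.2.2 hr θ = 1 := ContDiffBump.one_of_mem_closedBall _ h1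
      rw [h4, Complex.ofReal_one, sub_self, zero_mul]
  all_goals
    have hprod : Integrable fun w => starRingEnd ℂ (𝓕 ((bumpCutoff z₀.1 hr).wave v.1 h) w) *
        𝓕 ((bumpCutoff z₀.2.1 hr).wave v.2 h) w := by
      simp_rw [Cutoff.fourier_wave]
      have h1 : Integrable fun w => (𝓕 (bumpCutoff z₀.2.1 hr).schwartz)
          (w - (2 * Real.pi * h)⁻¹ • v.2) := (SchwartzMap.integrable _).comp_sub_right _
      obtain ⟨C', -, hC'⟩ := schwartz_decay (𝓕 (bumpCutoff z₀.1 hr).schwartz) 0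
      refine h1.bdd_mul (c := C') ?_ (Eventually.of_forall fun w => ?_)
      · refine Continuous.aestronglyMeasurable ?_
        have := (𝓕 (bumpCutoff z₀.1 hr).schwartz).continuous
        fun_prop
      · rw [RCLike.norm_conj]
        simpa using hC' (w - (2 * Real.pi * h)⁻¹ • v.1)
  · refine hprod.bdd_mul (c := 1) ?_ (Eventually.of_forall fun w => (norm_phaseFactor _ _ _ _).le)
    exact ((measurable_phaseFactor s h k).comp (measurable_const_smul _)).aestronglyMeasurable
  · refine hprod.bdd_mul (c := 1) ?_ (Eventually.of_forall fun w => ?_)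
    · refine (Continuous.aestronglyMeasurable ?_).mul
        ((measurable_phaseFactor s h k).comp (measurable_const_smul _)).aestronglyMeasurable
      have := (bumpCutoff z₀.2.2 hr).smooth.continuous
      exact this.comp (continuous_const_smul _)
    · rw [norm_mul, norm_phaseFactor, mul_one, Complex.norm_real,
        Real.norm_of_nonneg (bump z₀.2.2 hr).nonneg]
      exact (bump z₀.2.2 hr).le_one

lemma exists_closedBall_subset {Ω : Set (Plane × Plane × Plane)} (hΩ : IsOpen Ω)
    {z : Plane × Plane × Plane} (hz : z ∈ Ω) : ∃ r > 0, Metric.closedBall z (4 * r) ⊆ Ω := by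
  obtain ⟨R, hR, h⟩ := Metric.nhds_basis_closedBall.mem_iff.1 (hΩ.mem_nhds hz)
  exact ⟨R / 4, by positivity, by rwa [mul_div_cancel₀ _ (by norm_num : (4 : ℝ) ≠ 0)]⟩

lemma isEllipticFIOAt_aliasOp {s : ℝ} (hs : 0 < s) (k : ℤ) {c : Phase2}
    (hc : c ∈ canonicalRelation s k) :
    IsEllipticFIOAt (admissible s) (fun h => aliasOp s h k) (canonicalRelation s k) 0 c := by
  obtain ⟨h0, h1, h2⟩ := (mem_canonicalRelation_iff _ _ _).1 hc
  set z₀ : Plane × Plane × Plane := (c.1.1, c.2.1, c.1.2) with hz₀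
  have hz : z₀ ∈ phaseDomain c.1.2 := real_inner_self_pos.2 h0
  obtain ⟨r, hr, hball⟩ := exists_closedBall_subset (isOpen_phaseDomain c.1.2) hz
  have hc' : c = ((z₀.1, z₀.2.2), (z₀.2.1, z₀.2.2)) := Prod.ext rfl (Prod.ext rfl h1)
  refine ⟨2, phase (2 * Real.pi * k / s) c.1.2, phaseDomain c.1.2, fun _ => amplitude z₀ hr,
    parametrizes_phase hc, ⟨fun _ _ => contDiff_amplitude z₀ hr, ?_, ?_⟩, ?_, z₀, hz, ?_, ?_⟩
  · exact ⟨tsupport (amplitude z₀ hr), hasCompactSupport_amplitude z₀ hr,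
      (tsupport_amplitude z₀ hr).trans hball, fun _ _ => subset_rfl⟩
  · intro n
    obtain ⟨C, hC⟩ := ((hasCompactSupport_amplitude z₀ hr).iteratedFDeriv (𝕜 := ℝ)
      n).exists_bound_of_continuous ((contDiff_amplitude z₀ hr).continuous_iteratedFDeriv
        (by exact_mod_cast le_top))
    exact ⟨C, fun h _ z => by simpa using hC z⟩
  · have := agreesNear_oscKernel hs k hr h0 hball
    rwa [← hc'] at this
  · exact (criticalOver_phase_iff _ hz _).2 ⟨hc', h2⟩
  · have e : ∀ (c : Plane) (r : ℝ) (hr : 0 < r), bump c hr c = 1 := fun c r hr =>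
      (bump c hr).one_of_mem_closedBall (Metric.mem_closedBall_self hr.le)
    refine ⟨1, one_pos, 1, one_pos, fun h _ _ => ?_⟩
    simp [amplitude, e]

/-- A kernel that is uniformly `O(h^∞)` agrees with zero. -/
lemma AgreesNear.zero_of_isBigO {H : Set ℝ} {A : ℝ → L2 →L[ℂ] L2} {K : ℝ → Plane → Plane → ℂ}
    {c : Phase2} (hA : AgreesNear H A K c)
    (hK : ∀ N : ℕ, ∃ C, 0 ≤ C ∧ ∀ h ∈ H, ∀ x y, ‖K h x y‖ ≤ C * h ^ N) : AgreesNear H A 0 c := by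
  obtain ⟨χ₁, χ₂, h1, h2, V, hV, h3⟩ := hA
  refine ⟨χ₁, χ₂, h1, h2, V, hV, fun N => ?_⟩
  obtain ⟨C, h₀, hh₀, h4⟩ := h3 N
  obtain ⟨C', hC', h5⟩ := hK N
  have hχ : ∀ χ : Cutoff, Integrable fun x => ‖χ.toFun x‖ := fun χ =>
    (χ.smooth.continuous.integrable_of_hasCompactSupport χ.compact).norm
  have hw : ∀ (χ : Cutoff) (ξ : Plane) (h : ℝ) (x : Plane), ‖χ.wave ξ h x‖ = ‖χ.toFun x‖ := by
    intro χ ξ h x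
    rw [Cutoff.wave, norm_mul, mul_comm Complex.I, Complex.norm_exp_ofReal_mul_I, mul_one]
  refine ⟨C + (∫ x, ‖χ₁.toFun x‖) * (C' * ∫ y, ‖χ₂.toFun y‖), h₀, hh₀, fun h hh hlt v hv => ?_⟩
  have h6 := h4 h hh hlt v hv
  have h7 : ‖∫ x, ∫ y, starRingEnd ℂ (χ₁.wave v.1 h x) * K h x y * χ₂.wave v.2 h y‖ ≤
      ((∫ x, ‖χ₁.toFun x‖) * (C' * ∫ y, ‖χ₂.toFun y‖)) * h ^ N := by
    refine (norm_integral_le_of_norm_le ((hχ χ₁).mul_const (C' * h ^ N * ∫ y, ‖χ₂.toFun y‖))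
      (Eventually.of_forall fun x => ?_)).trans_eq ?_
    · have h8 : Integrable fun y => ‖χ₁.toFun x‖ * (C' * h ^ N) * ‖χ₂.toFun y‖ :=
        (hχ χ₂).const_mul _
      refine (norm_integral_le_of_norm_le h8 (Eventually.of_forall fun y => ?_)).trans_eq ?_
      · rw [norm_mul, norm_mul, RCLike.norm_conj, hw, hw]
        gcongr
        exact h5 h hh x y
      · rw [integral_const_mul]
        ring
    · rw [integral_mul_const]
      ring
  simp only [Pi.zero_apply, mul_zero, zero_mul, integral_zero, sub_zero]
  rw [add_mul]
  refine (norm_le_norm_sub_add _ _).trans (add_le_add h6 h7)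

/-- Away from the canonical relation, the kernel is negligible: for distinct frequencies there is no
overlap on the Fourier side, and for equal ones the phase is not stationary in `θ`. -/
lemma agreesNear_zero_aliasOp {s : ℝ} (hs : 0 < s) (k : ℤ) {c : Phase2}
    (hc : c ∉ canonicalRelation s k) (h0 : (c.1.2, c.2.2) ≠ (0, 0)) :
    AgreesNear (admissible s) (fun h => aliasOp s h k) 0 c := by
  by_cases hξ : c.1.2 = c.2.2
  · have hne : c.1.2 ≠ 0 := fun h => h0 (Prod.ext h (hξ ▸ h))
    set κ := 2 * Real.pi * k / s with hκ
    set z₀ : Plane × Plane × Plane := (c.1.1, c.2.1, c.1.2) with hz₀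
    have hz : z₀ ∈ phaseDomain c.1.2 := real_inner_self_pos.2 hne
    -- the gradient of the phase in `θ` at `z₀`
    set v : Plane := c.1.1 - c.2.1 + (κ * (‖c.1.2‖ ^ 2)⁻¹) • perp c.1.2 with hv
    have hv0 : v ≠ 0 := by
      intro h
      refine hc ((mem_canonicalRelation_iff _ _ _).2 ⟨hne, hξ.symm, ?_⟩)
      rw [hv, sub_add_eq_add_sub, sub_eq_zero] at h
      exact h.symm
    have hgrad : fderiv ℝ (phase κ c.1.2) z₀ (0, 0, v) = inner ℝ v v := by
      rw [fderiv_phase κ hz]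
      conv_rhs => rw [hv]
      rw [← hv, inner_add_left, real_inner_smul_left]
      simp [hz₀]
      ring
    set Ω : Set (Plane × Plane × Plane) :=
      phaseDomain c.1.2 ∩ {z | fderiv ℝ (phase κ c.1.2) z (0, 0, v) ≠ 0} with hΩ
    have hΩo : IsOpen Ω := by
      refine ContinuousOn.isOpen_inter_preimage (t := {0}ᶜ) ?_ (isOpen_phaseDomain _)
        isOpen_compl_singleton
      exact ((contDiffOn_phase κ c.1.2).continuousOn_fderiv_of_isOpen (isOpen_phaseDomain _)
        (by simp)).clm_apply continuousOn_const
    have hzΩ : z₀ ∈ Ω := ⟨hz, by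
      simp only [Set.mem_ofPred_eq]
      rw [hgrad]
      exact inner_self_ne_zero.2 hv0⟩
    obtain ⟨r, hr, hball⟩ := exists_closedBall_subset hΩo hzΩ
    have hA := agreesNear_oscKernel hs k (z₀ := z₀) hr hne (hball.trans Set.inter_subset_left)
    have hc' : c = ((z₀.1, z₀.2.2), (z₀.2.1, z₀.2.2)) := Prod.ext rfl (Prod.ext rfl hξ.symm)
    rw [← hc'] at hA
    refine hA.zero_of_isBigO fun N => ?_
    obtain ⟨C, hC, h1⟩ := exists_norm_integral_exp_le hΩo
      ((contDiffOn_phase κ c.1.2).mono Set.inter_subset_left) v (fun z hz => hz.2) (N + 2)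
      (contDiff_amplitude z₀ hr) (hasCompactSupport_amplitude z₀ hr)
      ((tsupport_amplitude z₀ hr).trans hball)
    refine ⟨((2 * Real.pi) ^ 2)⁻¹ * C, by positivity, fun h hh x y => ?_⟩
    have hpos := admissible_pos hs hh
    rw [oscKernel_eq _ _ hpos, norm_mul, Complex.norm_real, Real.norm_of_nonneg (by positivity)]
    calc _ ≤ ((2 * Real.pi * h) ^ 2)⁻¹ * (C * h ^ (N + 2)) := by
          gcongr
          exact h1 h hpos x y
      _ = _ := by
          rw [mul_pow (2 * Real.pi), pow_add]
          field_simp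
  · set d := ‖c.1.2 - c.2.2‖ with hd
    have hdpos : 0 < d := norm_pos_iff.2 (sub_ne_zero.2 hξ)
    refine ⟨bumpCutoff c.1.1 one_pos, bumpCutoff c.2.1 one_pos, bumpCutoff_self _ _,
      bumpCutoff_self _ _, Metric.ball c.1.2 (d / 4) ×ˢ Metric.ball c.2.2 (d / 4),
      prod_mem_nhds (Metric.ball_mem_nhds _ (by positivity))
        (Metric.ball_mem_nhds _ (by positivity)), fun N => ?_⟩
    obtain ⟨C, hC⟩ := exists_overlap_le (𝓕 (bumpCutoff c.1.1 one_pos).schwartz)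
      (𝓕 (bumpCutoff c.2.1 one_pos).schwartz) (half_pos hdpos) N
    refine ⟨C, 1, one_pos, fun h hh _ v hv => ?_⟩
    have hpos := admissible_pos hs hh
    simp only [Pi.zero_apply, mul_zero, zero_mul, integral_zero, sub_zero]
    rw [inner_packet_aliasOp]
    simp_rw [Cutoff.fourier_wave]
    refine hC h hpos v.1 v.2 (phaseFactor s h k) (fun θ => (norm_phaseFactor _ _ _ _).le) ?_
    intro θ hθ
    exfalso
    have h1 : dist v.1 c.1.2 < d / 4 := hv.1
    have h2 : dist v.2 c.2.2 < d / 4 := hv.2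
    rw [← dist_eq_norm, ← dist_eq_norm] at hθ
    rw [← dist_eq_norm] at hd
    have h3 := dist_triangle4 c.1.2 v.1 v.2 c.2.2
    have h4 := dist_triangle_left v.1 v.2 θ
    rw [dist_comm] at h1
    linarith

lemma isEllipticFIO_aliasOp {s : ℝ} (hs : 0 < s) (k : ℤ) :
    IsEllipticFIO (admissible s) (fun h => aliasOp s h k) (canonicalRelation s k) 0 where
  elliptic _ hc _ := isEllipticFIOAt_aliasOp hs k hc
  negligible _ hc h0 := agreesNear_zero_aliasOp hs k hc h0

/-! ### The Hilbert transform and the ramp filter on the Fourier side -/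

lemma integral_eq_integral_Ioi_add_neg {F : ℝ → ℂ} (hF : Integrable F) :
    ∫ u, F u = ∫ u in Set.Ioi (0 : ℝ), (F u + F (-u)) := by
  have h1 : ∫ u in Set.Ioi (0 : ℝ), F (-u) = ∫ u in Set.Iic (0 : ℝ), F u := by
    simp [integral_comp_neg_Ioi]
  rw [integral_add hF.integrableOn hF.comp_neg.integrableOn, h1, add_comm,
    intervalIntegral.integral_Iic_add_Ioi hF.integrableOn hF.integrableOn]

/-- The odd part `g (p - u) - g (p + u)` divided by `u` is dominated by an integrable function: by a
Lipschitz constant for `u ≤ 1`, and by the values of `g` for `u > 1`. -/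
lemma exists_bound_oddPart_div (g : 𝓢(ℝ, ℂ)) (p : ℝ) :
    ∃ M : ℝ → ℝ, IntegrableOn M (Set.Ioi 0) ∧
      ∀ u > 0, ‖(g (p - u) - g (p + u)) / (u : ℂ)‖ ≤ M u := by
  obtain ⟨L, hL⟩ : ∃ L, ∀ x, ‖deriv g x‖ ≤ L := by
    obtain ⟨L, -, hL⟩ := (SchwartzMap.derivCLM ℂ ℂ g).decay 0 0
    exact ⟨L, fun x => by simpa using hL x⟩
  have hL0 : 0 ≤ L := (norm_nonneg _).trans (hL 0)
  have hLip : ∀ x y, ‖g y - g x‖ ≤ L * ‖y - x‖ := fun x y =>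
    convex_univ.norm_image_sub_le_of_norm_deriv_le (fun x _ => g.differentiableAt)
      (fun x _ => hL x) (Set.mem_univ x) (Set.mem_univ y)
  refine ⟨fun u => (Set.Ioc 0 1).indicator (fun _ => 2 * L) u + (‖g (p - u)‖ + ‖g (p + u)‖), ?_, ?_⟩
  · refine Integrable.integrableOn (Integrable.add ?_ (Integrable.add ?_ ?_))
    · exact (integrable_indicator_iff measurableSet_Ioc).2 (integrableOn_const (by simp))
    · exact (g.integrable.comp_sub_left p).norm
    · exact (g.integrable.comp_add_left p).norm
  · intro u hu
    rw [norm_div, Complex.norm_real, Real.norm_of_nonneg (le_of_lt hu)]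
    simp only
    by_cases h1 : u ≤ 1
    · rw [Set.indicator_of_mem (show u ∈ Set.Ioc (0 : ℝ) 1 from ⟨hu, h1⟩)]
      have : ‖g (p - u) - g (p + u)‖ / u ≤ 2 * L := by
        rw [div_le_iff₀ hu]
        refine (hLip _ _).trans_eq ?_
        rw [show p - u - (p + u) = -(2 * u) by ring, norm_neg, Real.norm_of_nonneg (by linarith)]
        ring
      have h2 := norm_nonneg (g (p - u))
      have h3 := norm_nonneg (g (p + u))
      linarith
    · rw [Set.indicator_of_notMem (show u ∉ Set.Ioc (0 : ℝ) 1 from fun h => h1 h.2), zero_add]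
      refine (div_le_self (norm_nonneg _) (le_of_not_ge h1)).trans (norm_sub_le _ _)

lemma hilbertTrunc_eq (g : 𝓢(ℝ, ℂ)) (p : ℝ) {ε : ℝ} (hε : 0 < ε) :
    hilbertTrunc g p ε = (1 / Real.pi : ℝ) * ∫ u in Set.Ioi (0 : ℝ),
      (Set.Ioi ε).indicator (fun u => (g (p - u) - g (p + u)) / (u : ℂ)) u := by
  rw [hilbertTrunc]
  congr 1
  set F : ℝ → ℂ := fun u => {u : ℝ | ε < |u|}.indicator (fun u => g (p - u) / (u : ℂ)) u with hF
  have hmeas : MeasurableSet {u : ℝ | ε < |u|} := measurableSet_lt measurable_const (by fun_prop)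
  have hmeas' : MeasurableSet {t : ℝ | ε < |p - t|} :=
    measurableSet_lt measurable_const (by fun_prop)
  have hFi : Integrable F := by
    refine Integrable.mono' ((g.integrable.comp_sub_left p).norm.div_const ε) ?_
      (Eventually.of_forall fun u => ?_)
    · refine (AEStronglyMeasurable.indicator ?_ hmeas)
      have h1 : Measurable fun u : ℝ => g (p - u) := (g.continuous.comp (by fun_prop)).measurable
      exact (h1.div (by fun_prop)).aestronglyMeasurable
    · rw [hF]
      by_cases hu : u ∈ {u : ℝ | ε < |u|}
      · simp only [Set.indicator_of_mem hu, norm_div, Complex.norm_real, Real.norm_eq_abs]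
        have : ε < |u| := hu
        gcongr
      · simp only [Set.indicator_of_notMem hu, norm_zero]
        positivity
  rw [← integral_indicator hmeas']
  have h1 : ∫ t, {t : ℝ | ε < |p - t|}.indicator (fun t => g t / ((p - t : ℝ) : ℂ)) t =
      ∫ t, F (p - t) := by
    congr 1
    funext t
    rw [hF]
    simp only [Set.indicator, Set.mem_ofPred_eq, sub_sub_cancel]
  rw [h1, integral_sub_left_eq_self F volume p, integral_eq_integral_Ioi_add_neg hFi]
  refine setIntegral_congr_fun measurableSet_Ioi fun u hu => ?_
  have hu' : 0 < u := hu
  simp only [hF, Set.indicator, Set.mem_ofPred_eq, abs_neg, abs_of_pos hu', Set.mem_Ioi]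
  split_ifs with h
  · rw [sub_neg_eq_add, Complex.ofReal_neg]
    ring
  · simp

lemma tendsto_hilbertTrunc (g : 𝓢(ℝ, ℂ)) (p : ℝ) :
    Tendsto (hilbertTrunc g p) (𝓝[>] (0 : ℝ)) (𝓝 ((1 / Real.pi : ℝ) *
      ∫ u in Set.Ioi (0 : ℝ), (g (p - u) - g (p + u)) / (u : ℂ))) := by
  obtain ⟨M, hM, hb⟩ := exists_bound_oddPart_div g p
  have hmeas : Measurable fun u : ℝ => (g (p - u) - g (p + u)) / (u : ℂ) := by
    have h1 : Measurable fun u : ℝ => g (p - u) := (g.continuous.comp (by fun_prop)).measurable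
    have h2 : Measurable fun u : ℝ => g (p + u) := (g.continuous.comp (by fun_prop)).measurable
    fun_prop
  have h1 : Tendsto (fun ε : ℝ => ((1 / Real.pi : ℝ) : ℂ) * ∫ u in Set.Ioi (0 : ℝ),
      (Set.Ioi ε).indicator (fun u => (g (p - u) - g (p + u)) / (u : ℂ)) u) (𝓝[>] (0 : ℝ))
      (𝓝 ((1 / Real.pi : ℝ) * ∫ u in Set.Ioi (0 : ℝ), (g (p - u) - g (p + u)) / (u : ℂ))) := by
    refine Tendsto.const_mul _ (tendsto_integral_filter_of_dominated_convergence M ?_ ?_ hM ?_)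
    · exact Eventually.of_forall fun ε =>
        (hmeas.indicator measurableSet_Ioi).aestronglyMeasurable
    · refine Eventually.of_forall fun ε => (ae_restrict_iff' measurableSet_Ioi).2
        (Eventually.of_forall fun u hu => ?_)
      exact (norm_indicator_le_norm_self _ _).trans (hb u hu)
    · refine (ae_restrict_iff' measurableSet_Ioi).2 (Eventually.of_forall fun u hu => ?_)
      refine tendsto_const_nhds.congr' ?_
      filter_upwards [nhdsWithin_le_nhds (Iio_mem_nhds (show (0 : ℝ) < u from hu))] with ε hε
      rw [Set.indicator_of_mem (show u ∈ Set.Ioi ε from hε)]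
  refine h1.congr' ?_
  filter_upwards [self_mem_nhdsWithin] with ε hε
  rw [hilbertTrunc_eq g p hε]

/-- The damped multiplier `sgn σ exp (-2 π ε |σ|) exp (2 π i p σ)` of the Hilbert transform. -/
def dampedSign (p ε σ : ℝ) : ℂ :=
  if 0 < σ then Complex.exp (-(2 * Real.pi * (ε - Complex.I * p)) * σ)
  else -Complex.exp ((2 * Real.pi * (ε + Complex.I * p)) * σ)

lemma integrable_dampedSign (p : ℝ) {ε : ℝ} (hε : 0 < ε) : Integrable (dampedSign p ε) := by
  have hpos : 0 < 2 * Real.pi * ε := by positivity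
  rw [← integrableOn_univ, ← Set.Iic_union_Ioi (a := (0 : ℝ))]
  refine IntegrableOn.union ?_ ?_
  · refine (integrableOn_exp_mul_complex_Iic (a := 2 * Real.pi * (ε + Complex.I * p))
      (by simpa using hpos) 0).neg.congr_fun (fun σ hσ => ?_) measurableSet_Iic
    rw [dampedSign, if_neg (not_lt.2 hσ)]
    rfl
  · refine (integrableOn_exp_mul_complex_Ioi (a := -(2 * Real.pi * (ε - Complex.I * p)))
      (by simpa using hpos) 0).congr_fun (fun σ hσ => ?_) measurableSet_Ioi
    rw [dampedSign, if_pos (show 0 < σ from hσ)]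

lemma fourier_dampedSign (p : ℝ) {ε : ℝ} (hε : 0 < ε) (t : ℝ) :
    𝓕 (dampedSign p ε) t = Complex.I / Real.pi * (((p - t) / ((p - t) ^ 2 + ε ^ 2) : ℝ) : ℂ) := by
  have hpos : 0 < 2 * Real.pi * ε := by positivity
  have hi := (Real.fourierIntegral_convergent_iff (μ := volume) (f := dampedSign p ε) t).2
    (integrable_dampedSign p hε)
  rw [Real.fourier_eq, integral_eq_integral_Ioi_add_neg hi]
  set a : ℂ := -(2 * Real.pi * (ε - Complex.I * (p - t))) with ha
  set b : ℂ := -(2 * Real.pi * (ε + Complex.I * (p - t))) with hb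
  have har : a.re < 0 := by simpa [ha] using hpos
  have hbr : b.re < 0 := by simpa [hb] using hpos
  have h1 : ∀ σ ∈ Set.Ioi (0 : ℝ), Real.fourierChar (-inner ℝ σ t) • dampedSign p ε σ +
      Real.fourierChar (-inner ℝ (-σ) t) • dampedSign p ε (-σ) =
      Complex.exp (a * σ) - Complex.exp (b * σ) := by
    intro σ hσ
    have hσ' : 0 < σ := hσ
    rw [dampedSign, if_pos hσ', dampedSign, if_neg (by linarith), Circle.smul_def, Circle.smul_def,
      Real.fourierChar_apply, Real.fourierChar_apply, smul_eq_mul, smul_eq_mul, mul_neg (Complex.exp _),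
      ← Complex.exp_add, ← Complex.exp_add, ← sub_eq_add_neg]
    congr 2 <;>
    · simp only [ha, hb, RCLike.inner_apply, conj_trivial]
      push_cast
      ring
  rw [setIntegral_congr_fun measurableSet_Ioi h1,
    integral_sub (integrableOn_exp_mul_complex_Ioi har 0) (integrableOn_exp_mul_complex_Ioi hbr 0),
    integral_exp_mul_complex_Ioi har, integral_exp_mul_complex_Ioi hbr]
  have ha0 : a ≠ 0 := fun h => by simp [h] at har
  have hb0 : b ≠ 0 := fun h => by simp [h] at hbr
  have hpi : (Real.pi : ℂ) ≠ 0 := by exact_mod_cast Real.pi_ne_zero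
  have hq : (((p - t) ^ 2 + ε ^ 2 : ℝ) : ℂ) ≠ 0 := by
    exact_mod_cast (by positivity : (p - t) ^ 2 + ε ^ 2 ≠ 0)
  have hab : a * b = (2 * Real.pi) ^ 2 * (((p - t) ^ 2 + ε ^ 2 : ℝ) : ℂ) := by
    rw [ha, hb]
    push_cast
    linear_combination (-(2 * Real.pi) ^ 2 * (p - t) ^ 2 : ℂ) * Complex.I_sq
  have h2 : ∀ z : ℂ, Complex.exp (z * ((0 : ℝ) : ℂ)) = 1 := fun z => by simp
  rw [h2, h2]
  have h3 : -1 / a - -1 / b = (a - b) / (a * b) := by field_simp; ring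
  rw [h3, hab, Complex.ofReal_div, ha, hb]
  field_simp
  push_cast
  ring

lemma integral_fourier_mul_dampedSign (g : 𝓢(ℝ, ℂ)) (p : ℝ) {ε : ℝ} (hε : 0 < ε) :
    ∫ σ, 𝓕 (g : ℝ → ℂ) σ * dampedSign p ε σ = Complex.I / Real.pi *
      ∫ u in Set.Ioi (0 : ℝ), (g (p - u) - g (p + u)) / (u : ℂ) *
        ((u ^ 2 / (u ^ 2 + ε ^ 2) : ℝ) : ℂ) := by
  have h1 := VectorFourier.integral_fourierIntegral_smul_eq_flip (μ := (volume : Measure ℝ))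
    (ν := (volume : Measure ℝ)) (L := innerₗ ℝ) (f := g) (g := dampedSign p ε)
    Real.continuous_fourierChar (by simp only [innerₗ_apply_apply]; fun_prop) g.integrable
    (integrable_dampedSign p hε)
  rw [flip_innerₗ] at h1
  have h2 : ∫ σ, 𝓕 (g : ℝ → ℂ) σ * dampedSign p ε σ = ∫ t, g t * 𝓕 (dampedSign p ε) t := h1
  rw [h2]
  simp_rw [fourier_dampedSign p hε]
  set F : ℝ → ℂ := fun u => g (p - u) * ((u / (u ^ 2 + ε ^ 2) : ℝ) : ℂ) with hF
  have hFi : Integrable F := by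
    refine (g.integrable.comp_sub_left p).mul_bdd (c := ε⁻¹) ?_ (Eventually.of_forall fun u => ?_)
    · refine Continuous.aestronglyMeasurable (Complex.continuous_ofReal.comp ?_)
      refine continuous_id.div (by fun_prop) fun u => ?_
      positivity
    · rw [Complex.norm_real, Real.norm_eq_abs, abs_div, abs_of_pos (by positivity : 0 < u ^ 2 + ε ^ 2),
        div_le_iff₀ (by positivity), ← div_eq_inv_mul, le_div_iff₀ hε, ← sq_abs u]
      nlinarith [sq_nonneg (|u| - ε), abs_nonneg u]
  have h3 : ∫ t, g t * (Complex.I / Real.pi * (((p - t) / ((p - t) ^ 2 + ε ^ 2) : ℝ) : ℂ)) =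
      Complex.I / Real.pi * ∫ t, F (p - t) := by
    rw [← integral_const_mul]
    congr 1
    funext t
    simp only [hF, sub_sub_cancel]
    ring
  rw [h3, integral_sub_left_eq_self F volume p, integral_eq_integral_Ioi_add_neg hFi]
  congr 1
  refine setIntegral_congr_fun measurableSet_Ioi fun u hu => ?_
  have hu' : (u : ℂ) ≠ 0 := by exact_mod_cast (ne_of_gt hu : u ≠ 0)
  have hq : ((u : ℂ) ^ 2 + (ε : ℂ) ^ 2) ≠ 0 := by
    exact_mod_cast (by positivity : u ^ 2 + ε ^ 2 ≠ 0)
  simp only [hF, sub_neg_eq_add, neg_sq]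
  push_cast
  field_simp
  ring

/-- The principal value as an integral on the Fourier side: both sides are limits as `ε → 0` of the
two sides of `integral_fourier_mul_dampedSign`. -/
lemma integral_oddPart_div (g : 𝓢(ℝ, ℂ)) (p : ℝ) :
    Complex.I / Real.pi * ∫ u in Set.Ioi (0 : ℝ), (g (p - u) - g (p + u)) / (u : ℂ) =
      ∫ σ in Set.Ioi (0 : ℝ),
        (𝓕 (g : ℝ → ℂ) σ * Complex.exp (2 * Real.pi * Complex.I * p * σ) -
          𝓕 (g : ℝ → ℂ) (-σ) * Complex.exp (-(2 * Real.pi * Complex.I * p * σ))) := by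
  have hgF : Integrable (𝓕 (g : ℝ → ℂ)) := by
    rw [← SchwartzMap.fourier_coe]; exact SchwartzMap.integrable _
  have hgc : Continuous (𝓕 (g : ℝ → ℂ)) := by
    rw [← SchwartzMap.fourier_coe]; exact SchwartzMap.continuous _
  have hR : Tendsto (fun ε : ℝ => Complex.I / Real.pi *
      ∫ u in Set.Ioi (0 : ℝ), (g (p - u) - g (p + u)) / (u : ℂ) *
        ((u ^ 2 / (u ^ 2 + ε ^ 2) : ℝ) : ℂ)) (𝓝[>] (0 : ℝ))
      (𝓝 (Complex.I / Real.pi *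
        ∫ u in Set.Ioi (0 : ℝ), (g (p - u) - g (p + u)) / (u : ℂ))) := by
    obtain ⟨M, hM, hb⟩ := exists_bound_oddPart_div g p
    refine Tendsto.const_mul _ (tendsto_integral_filter_of_dominated_convergence M ?_ ?_ hM ?_)
    · refine Eventually.of_forall fun ε => Measurable.aestronglyMeasurable ?_
      have h1 : Measurable fun u : ℝ => g (p - u) := (g.continuous.comp (by fun_prop)).measurable
      have h2 : Measurable fun u : ℝ => g (p + u) := (g.continuous.comp (by fun_prop)).measurable
      fun_prop
    · refine Eventually.of_forall fun ε => (ae_restrict_iff' measurableSet_Ioi).2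
        (Eventually.of_forall fun u hu => ?_)
      rw [norm_mul, Complex.norm_real, Real.norm_of_nonneg (by positivity)]
      refine (mul_le_of_le_one_right (norm_nonneg _) ?_).trans (hb u hu)
      exact div_le_one_of_le₀ (by nlinarith [sq_nonneg ε]) (by positivity)
    · refine (ae_restrict_iff' measurableSet_Ioi).2 (Eventually.of_forall fun u hu => ?_)
      have hu' : u ^ 2 + (0 : ℝ) ^ 2 ≠ 0 := by
        have : 0 < u := hu
        positivity
      have hc : ContinuousAt (fun ε : ℝ => (g (p - u) - g (p + u)) / (u : ℂ) *
          ((u ^ 2 / (u ^ 2 + ε ^ 2) : ℝ) : ℂ)) 0 := by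
        refine continuousAt_const.mul (Complex.continuous_ofReal.continuousAt.comp
          (f := fun ε : ℝ => u ^ 2 / (u ^ 2 + ε ^ 2)) ?_)
        exact continuousAt_const.div (by fun_prop) hu'
      have h1 := hc.tendsto.mono_left (nhdsWithin_le_nhds (s := Set.Ioi 0))
      convert! h1 using 2
      have : u ≠ 0 := ne_of_gt hu
      simp [this]
  have hL : Tendsto (fun ε : ℝ => ∫ σ, 𝓕 (g : ℝ → ℂ) σ * dampedSign p ε σ) (𝓝[>] (0 : ℝ))
      (𝓝 (∫ σ, 𝓕 (g : ℝ → ℂ) σ * dampedSign p 0 σ)) := by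
    refine tendsto_integral_filter_of_dominated_convergence (fun σ => ‖𝓕 (g : ℝ → ℂ) σ‖) ?_ ?_
      hgF.norm ?_
    · filter_upwards [self_mem_nhdsWithin] with ε hε
      exact hgc.aestronglyMeasurable.mul (integrable_dampedSign p hε).aestronglyMeasurable
    · filter_upwards [self_mem_nhdsWithin] with ε hε
      have hε' : 0 < ε := hε
      refine Eventually.of_forall fun σ => ?_
      rw [norm_mul]
      refine mul_le_of_le_one_right (norm_nonneg _) ?_
      rw [dampedSign]
      have := Real.pi_pos
      split_ifs with hσ
      · rw [Complex.norm_exp, Real.exp_le_one_iff]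
        simp
        positivity
      · rw [norm_neg, Complex.norm_exp, Real.exp_le_one_iff]
        simp
        exact mul_nonpos_of_nonneg_of_nonpos (by positivity) (not_lt.1 hσ)
    · refine Eventually.of_forall fun σ => Tendsto.const_mul _ ?_
      have hc : Continuous fun ε : ℝ => dampedSign p ε σ := by
        unfold dampedSign
        split_ifs <;> fun_prop
      exact hc.continuousAt.tendsto.mono_left nhdsWithin_le_nhds
  have hL' := hL.congr' (f₂ := fun ε : ℝ => Complex.I / Real.pi *
      ∫ u in Set.Ioi (0 : ℝ), (g (p - u) - g (p + u)) / (u : ℂ) *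
        ((u ^ 2 / (u ^ 2 + ε ^ 2) : ℝ) : ℂ)) (by
    filter_upwards [self_mem_nhdsWithin] with ε hε
    exact integral_fourier_mul_dampedSign g p hε)
  rw [tendsto_nhds_unique hR hL', integral_eq_integral_Ioi_add_neg]
  · refine setIntegral_congr_fun measurableSet_Ioi fun σ hσ => ?_
    have hσ' : 0 < σ := hσ
    simp only [dampedSign, if_pos hσ', if_neg (by linarith : ¬ 0 < -σ)]
    rw [mul_neg, ← sub_eq_add_neg]
    congr 3 <;>
    · push_cast
      ring_nf
  · refine hgF.mul_bdd (c := 1) ?_ (Eventually.of_forall fun σ => ?_)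
    · refine Measurable.aestronglyMeasurable ?_
      unfold dampedSign
      exact Measurable.ite measurableSet_Ioi (by fun_prop) (by fun_prop)
    · rw [dampedSign]
      split_ifs with hσ
      · rw [Complex.norm_exp]; simp
      · rw [norm_neg, Complex.norm_exp]; simp

/-- The filter `(4 π)⁻¹ H d/dp` is the Fourier multiplier `|σ| / 2`, here with the integral over the
frequencies folded to the half line. -/
lemma ramp_eq (q : 𝓢(ℝ, ℂ)) (p : ℝ) : ramp q p = (1 / 2 : ℝ) * ∫ σ in Set.Ioi (0 : ℝ),
    (σ * (𝓕 (q : ℝ → ℂ) σ * Complex.exp (2 * Real.pi * Complex.I * p * σ) +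
      𝓕 (q : ℝ → ℂ) (-σ) * Complex.exp (-(2 * Real.pi * Complex.I * p * σ)))) := by
  set g : 𝓢(ℝ, ℂ) := SchwartzMap.derivCLM ℂ ℂ q with hg
  have hgq : deriv q = g := rfl
  have h1 : 𝓕 (g : ℝ → ℂ) = fun σ : ℝ => (2 * Real.pi * Complex.I * σ) • 𝓕 (q : ℝ → ℂ) σ :=
    Real.fourier_deriv q.integrable q.differentiable g.integrable
  have h2 := integral_oddPart_div g p
  rw [ramp, hilbert, hgq, (tendsto_hilbertTrunc g p).limUnder_eq]
  have hpi : (Real.pi : ℂ) ≠ 0 := by exact_mod_cast Real.pi_ne_zero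
  have h3 : ∀ J : ℂ, ((1 / Real.pi : ℝ) : ℂ) * J = -Complex.I * (Complex.I / Real.pi * J) := by
    intro J
    push_cast
    linear_combination (J / Real.pi) * Complex.I_sq
  rw [h3, h2, h1, ← integral_const_mul, ← integral_const_mul, ← integral_const_mul]
  congr 1
  funext σ
  push_cast
  simp only [smul_eq_mul]
  field_simp
  ring_nf
  rw [Complex.I_sq]
  ring

/-! ### The Radon transform and the Fourier slice theorem -/

lemma omega_zero_coord (φ : ℝ) : omega φ 0 = Real.cos φ := rfl

lemma omega_one_coord (φ : ℝ) : omega φ 1 = Real.sin φ := rfl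

lemma norm_sq_plane (ξ : Plane) : ‖ξ‖ ^ 2 = ξ 0 ^ 2 + ξ 1 ^ 2 := by
  rw [EuclideanSpace.norm_sq_eq, Fin.sum_univ_two]; simp

lemma norm_omega (φ : ℝ) : ‖omega φ‖ = 1 := by
  have : ‖omega φ‖ ^ 2 = 1 := by
    rw [norm_sq_plane, omega_zero_coord, omega_one_coord, Real.cos_sq_add_sin_sq]
  exact (pow_eq_one_iff_of_nonneg (norm_nonneg _) two_ne_zero).1 this

lemma omega_add_pi (φ : ℝ) : omega (φ + Real.pi) = -omega φ := by
  ext i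
  fin_cases i <;> simp [omega]

lemma omega_add_two_pi (φ : ℝ) : omega (φ + 2 * Real.pi) = omega φ := by
  ext i
  fin_cases i <;> simp [omega]

lemma norm_sq_frame (φ p t : ℝ) : ‖p • omega φ + t • perp (omega φ)‖ ^ 2 = p ^ 2 + t ^ 2 := by
  rw [norm_sq_plane]
  simp only [PiLp.add_apply, PiLp.smul_apply, perp_zero_coord, perp_one_coord, omega_zero_coord,
    omega_one_coord, smul_eq_mul]
  linear_combination (p ^ 2 + t ^ 2) * Real.cos_sq_add_sin_sq φ

lemma abs_le_norm_frame (φ p t : ℝ) :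
    |p| ≤ ‖p • omega φ + t • perp (omega φ)‖ ∧ |t| ≤ ‖p • omega φ + t • perp (omega φ)‖ := by
  have h := norm_sq_frame φ p t
  constructor <;> refine abs_le_of_sq_le_sq ?_ (norm_nonneg _) <;> nlinarith [sq_nonneg p, sq_nonneg t]

/-- The coordinates along and across the direction `omega φ` preserve the area. -/
lemma measurePreserving_frame (φ : ℝ) :
    MeasurePreserving (fun z : ℝ × ℝ => z.1 • omega φ + z.2 • perp (omega φ)) := by
  have h1 : MeasurePreserving (Complex.orthonormalBasisOneI.repr ∘
      (rotation (Circle.exp φ)) ∘ Complex.measurableEquivRealProd.symm) :=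
    Complex.orthonormalBasisOneI.measurePreserving_repr.comp
      ((rotation (Circle.exp φ)).measurePreserving.comp
        (Complex.volume_preserving_equiv_real_prod.symm))
  convert h1 using 1
  funext z
  ext i
  fin_cases i <;>
  simp [omega, perp, Complex.measurableEquivRealProd, Complex.exp_mul_I, ← Complex.ofReal_cos,
    ← Complex.ofReal_sin] <;>
  ring

lemma integral_frame (φ : ℝ) {F : Plane → ℂ} (hF : Continuous F) :
    ∫ x, F x = ∫ z : ℝ × ℝ, F (z.1 • omega φ + z.2 • perp (omega φ)) := by
  rw [← (measurePreserving_frame φ).map_eq, integral_map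
    (measurePreserving_frame φ).measurable.aemeasurable hF.aestronglyMeasurable]

lemma hasCompactSupport_radon {f : Plane → ℂ} (hc : HasCompactSupport f) (φ : ℝ) :
    HasCompactSupport (radon f (omega φ)) := by
  obtain ⟨R, hR⟩ := hc.isCompact.isBounded.subset_closedBall 0
  refine HasCompactSupport.of_support_subset_isCompact (isCompact_closedBall (0 : ℝ) R) ?_
  intro p hp
  by_contra h
  refine hp (integral_eq_zero_of_ae (Eventually.of_forall fun t => ?_))
  by_contra h0
  have h1 := mem_closedBall_zero_iff.1 (hR (subset_tsupport f h0))
  exact h (mem_closedBall_zero_iff.2 ((abs_le_norm_frame φ p t).1.trans h1))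

lemma hasDerivAt_radon {f : Plane → ℂ} (hf : ContDiff ℝ ∞ f) (hc : HasCompactSupport f)
    (φ p : ℝ) : HasDerivAt (radon f (omega φ))
      (radon (fun x => fderiv ℝ f x (omega φ)) (omega φ) p) p := by
  set g : Plane → ℂ := fun x => fderiv ℝ f x (omega φ) with hg
  have hgc : Continuous g := (hf.continuous_fderiv (by simp)).clm_apply continuous_const
  have hgs : HasCompactSupport g := hc.fderiv_apply ℝ _
  obtain ⟨R, hR⟩ := hc.isCompact.isBounded.subset_closedBall 0
  obtain ⟨M, hM⟩ := hgs.exists_bound_of_continuous hgc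
  have hM0 : 0 ≤ M := (norm_nonneg _).trans (hM 0)
  have hzero : ∀ u : Plane → ℂ, tsupport u ⊆ Metric.closedBall 0 R → ∀ p t : ℝ,
      t ∉ Metric.closedBall (0 : ℝ) R → u (p • omega φ + t • perp (omega φ)) = 0 := by
    intro u hu p t ht
    by_contra h0
    have h1 := mem_closedBall_zero_iff.1 (hu (subset_tsupport u h0))
    exact ht (mem_closedBall_zero_iff.2 ((abs_le_norm_frame φ p t).2.trans h1))
  have hline : ∀ u : Plane → ℂ, Continuous u → ∀ p : ℝ,
      Continuous fun t : ℝ => u (p • omega φ + t • perp (omega φ)) := fun u hu p =>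
    hu.comp (by fun_prop)
  refine (hasDerivAt_integral_of_dominated_loc_of_deriv_le (μ := volume)
    (F := fun p t => f (p • omega φ + t • perp (omega φ)))
    (F' := fun p t => g (p • omega φ + t • perp (omega φ)))
    (bound := (Metric.closedBall (0 : ℝ) R).indicator fun _ => M) univ_mem ?_ ?_ ?_ ?_ ?_ ?_).2
  · exact Eventually.of_forall fun p => (hline f hf.continuous p).aestronglyMeasurable
  · exact (hline f hf.continuous p).integrable_of_hasCompactSupport
      (HasCompactSupport.of_support_subset_isCompact (isCompact_closedBall (0 : ℝ) R)
        fun t ht => by_contra fun h => ht (hzero f hR p t h))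
  · exact (hline g hgc p).aestronglyMeasurable
  · refine Eventually.of_forall fun t p _ => ?_
    by_cases ht : t ∈ Metric.closedBall (0 : ℝ) R
    · rw [Set.indicator_of_mem ht]
      exact hM _
    · rw [hzero g ((tsupport_fderiv_apply_subset ℝ _).trans hR) p t ht, norm_zero,
        Set.indicator_of_notMem ht]
  · exact (integrable_indicator_iff measurableSet_closedBall).2
      (integrableOn_const (isCompact_closedBall _ _).measure_lt_top.ne)
  · refine Eventually.of_forall fun t p _ => ?_
    have h1 : HasDerivAt (fun p : ℝ => p • omega φ + t • perp (omega φ)) (omega φ) p := by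
      simpa using ((hasDerivAt_id p).smul_const (omega φ)).add_const (t • perp (omega φ))
    exact (hf.differentiable (by simp) _).hasFDerivAt.comp_hasDerivAt p h1

lemma contDiff_radon (φ : ℝ) (n : ℕ) : ∀ {f : Plane → ℂ}, ContDiff ℝ ∞ f → HasCompactSupport f →
    ContDiff ℝ n (radon f (omega φ)) := by
  induction n with
  | zero =>
    intro f hf hc
    exact contDiff_zero.2 (Differentiable.continuous (𝕜 := ℝ) fun p =>
      (hasDerivAt_radon hf hc φ p).differentiableAt)
  | succ n ih =>
    intro f hf hc
    have h1 : deriv (radon f (omega φ)) = radon (fun x => fderiv ℝ f x (omega φ)) (omega φ) :=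
      funext fun p => (hasDerivAt_radon hf hc φ p).deriv
    rw [Nat.cast_succ, contDiff_succ_iff_deriv, h1]
    exact ⟨fun p => (hasDerivAt_radon hf hc φ p).differentiableAt, by simp,
      ih ((hf.fderiv_right (m := ∞) (by simp)).clm_apply contDiff_const) (hc.fderiv_apply ℝ _)⟩

/-- The data in the direction of angle `φ`, as a Schwartz function. -/
def dataSchwartz (ψ : Plane → ℂ) {f : Plane → ℂ} (hf : ContDiff ℝ ∞ f) (hc : HasCompactSupport f)
    (φ : ℝ) : 𝓢(ℝ, ℂ) :=
  HasCompactSupport.toSchwartzMap (f := data ψ f φ) (hasCompactSupport_radon hc φ).mul_left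
    (contDiff_const.mul (contDiff_infty.2 fun n => contDiff_radon φ n hf hc))

lemma dataSchwartz_coe (ψ : Plane → ℂ) {f : Plane → ℂ} (hf : ContDiff ℝ ∞ f)
    (hc : HasCompactSupport f) (φ : ℝ) : ⇑(dataSchwartz ψ hf hc φ) = data ψ f φ := rfl

/-- The Fourier slice theorem. -/
lemma fourier_radon {f : Plane → ℂ} (hf : Continuous f) (hc : HasCompactSupport f) (φ σ : ℝ) :
    𝓕 (radon f (omega φ)) σ = 𝓕 f (σ • omega φ) := by
  have hcont : Continuous fun x : Plane =>
      Complex.exp (((-2 * Real.pi * inner ℝ x (σ • omega φ) : ℝ) : ℂ) * Complex.I) * f x := by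
    fun_prop
  rw [Real.fourier_eq', Real.fourier_eq']
  simp only [smul_eq_mul]
  have hint : Integrable fun z : ℝ × ℝ => Complex.exp (((-2 * Real.pi *
      inner ℝ (z.1 • omega φ + z.2 • perp (omega φ)) (σ • omega φ) : ℝ) : ℂ) * Complex.I) *
      f (z.1 • omega φ + z.2 • perp (omega φ)) :=
    (measurePreserving_frame φ).integrable_comp_of_integrable
      (hcont.integrable_of_hasCompactSupport hc.mul_left)
  rw [integral_frame φ hcont, Measure.volume_eq_prod, integral_prod _ hint]
  congr 1
  funext p
  rw [radon, ← integral_const_mul]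
  congr 1
  funext t
  congr 4
  have h1 : inner ℝ (p • omega φ + t • perp (omega φ)) (σ • omega φ) = σ * p := by
    rw [inner_eq]
    simp only [PiLp.add_apply, PiLp.smul_apply, perp_zero_coord, perp_one_coord, omega_zero_coord,
      omega_one_coord, smul_eq_mul]
    linear_combination (σ * p) * Real.cos_sq_add_sin_sq φ
  rw [h1]
  simp [RCLike.inner_apply]

/-! ### Integrals along rays -/

/-- The integral `∫_0^∞ σ E(σ ω) exp (2 π i σ x · ω) dσ` along the ray in the direction `ω` of
angle `φ`. -/
def rayIntegral (E : 𝓢(Plane, ℂ)) (x : Plane) (φ : ℝ) : ℂ :=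
  ∫ σ in Set.Ioi (0 : ℝ), σ * (E (σ • omega φ) *
    Complex.exp (2 * Real.pi * Complex.I * (inner ℝ x (σ • omega φ) : ℝ)))

lemma integrable_inv_one_add_abs_sq : Integrable fun σ : ℝ => ((1 + |σ|) ^ 2)⁻¹ := by
  have h := integrable_one_add_norm (E := ℝ) (μ := volume) (r := 2) (by simp)
  refine h.congr (Eventually.of_forall fun x => ?_)
  have : 0 ≤ 1 + |x| := by positivity
  change (1 + |x|) ^ (-2 : ℝ) = _
  rw [Real.rpow_neg this]
  norm_cast

lemma exists_bound_ray (E : 𝓢(Plane, ℂ)) : ∃ C, 0 ≤ C ∧ ∀ (x : Plane) (φ σ : ℝ), 0 < σ →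
    ‖(σ : ℂ) * (E (σ • omega φ) *
      Complex.exp (2 * Real.pi * Complex.I * (inner ℝ x (σ • omega φ) : ℝ)))‖ ≤
      C * ((1 + |σ|) ^ 2)⁻¹ := by
  obtain ⟨C, hC, h⟩ := schwartz_decay E 3
  refine ⟨C, hC, fun x φ σ hσ => ?_⟩
  have h1 := h (σ • omega φ)
  have h2 : ‖Complex.exp (2 * Real.pi * Complex.I * (inner ℝ x (σ • omega φ) : ℝ))‖ = 1 := by
    rw [Complex.norm_exp]; simp
  have h3 : ‖σ • omega φ‖ = |σ| := by rw [norm_smul, norm_omega, mul_one, Real.norm_eq_abs]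
  rw [h3] at h1
  rw [norm_mul, norm_mul, h2, mul_one, Complex.norm_real, Real.norm_eq_abs, ← div_eq_mul_inv,
    le_div_iff₀ (by positivity)]
  refine le_trans ?_ h1
  have : |σ| ≤ 1 + |σ| := by linarith
  calc |σ| * ‖E (σ • omega φ)‖ * (1 + |σ|) ^ 2 ≤ (1 + |σ|) * ‖E (σ • omega φ)‖ * (1 + |σ|) ^ 2 := by
        gcongr
    _ = _ := by ring

lemma integrableOn_ray (E : 𝓢(Plane, ℂ)) (x : Plane) (φ : ℝ) : IntegrableOn (fun σ : ℝ =>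
    (σ : ℂ) * (E (σ • omega φ) * Complex.exp (2 * Real.pi * Complex.I *
      (inner ℝ x (σ • omega φ) : ℝ)))) (Set.Ioi 0) := by
  obtain ⟨C, -, h⟩ := exists_bound_ray E
  refine Integrable.mono' (integrable_inv_one_add_abs_sq.const_mul C).integrableOn ?_
    ((ae_restrict_iff' measurableSet_Ioi).2 (Eventually.of_forall fun σ hσ => h x φ σ hσ))
  refine Continuous.aestronglyMeasurable ?_
  have := E.continuous
  fun_prop

lemma exists_bound_rayIntegral (E : 𝓢(Plane, ℂ)) : ∃ C, 0 ≤ C ∧ ∀ x φ, ‖rayIntegral E x φ‖ ≤ C := by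
  obtain ⟨C, hC, h⟩ := exists_bound_ray E
  refine ⟨∫ σ in Set.Ioi (0 : ℝ), C * ((1 + |σ|) ^ 2)⁻¹,
    integral_nonneg fun σ => by positivity, fun x φ => ?_⟩
  exact norm_integral_le_of_norm_le (integrable_inv_one_add_abs_sq.const_mul C).integrableOn
    ((ae_restrict_iff' measurableSet_Ioi).2 (Eventually.of_forall fun σ hσ => h x φ σ hσ))

lemma plane_eq (w : Plane) : w = w 0 • EuclideanSpace.single 0 1 + w 1 • EuclideanSpace.single 1 1 := by
  ext i
  fin_cases i <;> simp

lemma hasDerivAt_omega (φ : ℝ) : HasDerivAt omega (perp (omega φ)) φ := by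
  have h := ((Real.hasDerivAt_cos φ).smul_const (EuclideanSpace.single 0 1 : Plane)).add
    ((Real.hasDerivAt_sin φ).smul_const (EuclideanSpace.single 1 1 : Plane))
  rw [plane_eq (perp (omega φ))]
  exact h.congr_of_eventuallyEq (Eventually.of_forall fun φ => plane_eq (omega φ))

/-- The angular derivative of a ray integral is again a combination of ray integrals. The rotation
field maps Schwartz functions to Schwartz functions, so that the dependence on `x` is explicit. -/
lemma exists_hasDerivAt_rayIntegral (E : 𝓢(Plane, ℂ)) : ∃ E₀ E₁ E₂ : 𝓢(Plane, ℂ), ∀ x φ,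
    HasDerivAt (rayIntegral E x) (rayIntegral E₀ x φ + x 0 * rayIntegral E₁ x φ +
      x 1 * rayIntegral E₂ x φ) φ := by
  set c₀ : Plane → ℂ := fun w => (w 0 : ℂ) with hc₀
  set c₁ : Plane → ℂ := fun w => (w 1 : ℂ) with hc₁
  have ht₀ : c₀.HasTemperateGrowth :=
    (Complex.ofRealCLM ∘L (EuclideanSpace.proj 0 : Plane →L[ℝ] ℝ)).hasTemperateGrowth
  have ht₁ : c₁.HasTemperateGrowth :=
    (Complex.ofRealCLM ∘L (EuclideanSpace.proj 1 : Plane →L[ℝ] ℝ)).hasTemperateGrowth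
  set E₀ : 𝓢(Plane, ℂ) :=
    SchwartzMap.smulLeftCLM ℂ c₀ (LineDeriv.lineDerivOp (EuclideanSpace.single 1 1 : Plane) E) -
    SchwartzMap.smulLeftCLM ℂ c₁ (LineDeriv.lineDerivOp (EuclideanSpace.single 0 1 : Plane) E)
    with hE₀
  set E₁ : 𝓢(Plane, ℂ) := (-(2 * Real.pi * Complex.I)) • SchwartzMap.smulLeftCLM ℂ c₁ E with hE₁
  set E₂ : 𝓢(Plane, ℂ) := (2 * Real.pi * Complex.I) • SchwartzMap.smulLeftCLM ℂ c₀ E with hE₂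
  refine ⟨E₀, E₁, E₂, fun x φ => ?_⟩
  have e0 : ∀ w, E₀ w = fderiv ℝ E w (perp w) := by
    intro w
    rw [plane_eq (perp w), perp_zero_coord, perp_one_coord, map_add, map_smul, map_smul, hE₀,
      sub_apply, SchwartzMap.smulLeftCLM_apply_apply ht₀,
      SchwartzMap.smulLeftCLM_apply_apply ht₁, SchwartzMap.lineDerivOp_apply_eq_fderiv,
      SchwartzMap.lineDerivOp_apply_eq_fderiv]
    simp only [hc₀, hc₁, Complex.real_smul, smul_eq_mul]
    push_cast
    ring
  have e1 : ∀ w, E₁ w = -(2 * Real.pi * Complex.I) * (w 1 * E w) := by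
    intro w
    rw [hE₁, smul_apply, SchwartzMap.smulLeftCLM_apply_apply ht₁]
    rfl
  have e2 : ∀ w, E₂ w = (2 * Real.pi * Complex.I) * (w 0 * E w) := by
    intro w
    rw [hE₂, smul_apply, SchwartzMap.smulLeftCLM_apply_apply ht₀]
    rfl
  set P : 𝓢(Plane, ℂ) → ℝ → ℝ → ℂ := fun S φ σ => (σ : ℂ) * (S (σ • omega φ) *
    Complex.exp (2 * Real.pi * Complex.I * (inner ℝ x (σ • omega φ) : ℝ))) with hP
  obtain ⟨C₀, hC₀, hb₀⟩ := exists_bound_ray E₀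
  obtain ⟨C₁, hC₁, hb₁⟩ := exists_bound_ray E₁
  obtain ⟨C₂, hC₂, hb₂⟩ := exists_bound_ray E₂
  have hmeas : ∀ S φ, AEStronglyMeasurable (P S φ) (volume.restrict (Set.Ioi 0)) := fun S φ =>
    (integrableOn_ray S x φ).aestronglyMeasurable
  have main := hasDerivAt_integral_of_dominated_loc_of_deriv_le (μ := volume.restrict (Set.Ioi 0))
    (F := P E) (F' := fun φ σ => P E₀ φ σ + x 0 * P E₁ φ σ + x 1 * P E₂ φ σ) (x₀ := φ)
    (bound := fun σ => (C₀ + |x 0| * C₁ + |x 1| * C₂) * ((1 + |σ|) ^ 2)⁻¹) univ_mem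
    (Eventually.of_forall fun φ => hmeas E φ) (integrableOn_ray E x φ)
    (((hmeas _ φ).add ((hmeas _ φ).const_mul _)).add ((hmeas _ φ).const_mul _)) ?_
    (integrable_inv_one_add_abs_sq.const_mul _).integrableOn ?_
  · have h1 := main.2
    rw [integral_add, integral_add, integral_const_mul, integral_const_mul] at h1
    · exact h1
    · exact integrableOn_ray E₀ x φ
    · exact (integrableOn_ray E₁ x φ).const_mul _
    · exact (integrableOn_ray E₀ x φ).add ((integrableOn_ray E₁ x φ).const_mul _)
    · exact (integrableOn_ray E₂ x φ).const_mul _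
  · refine (ae_restrict_iff' measurableSet_Ioi).2 (Eventually.of_forall fun σ hσ φ _ => ?_)
    refine (norm_add₃_le).trans ?_
    rw [norm_mul (x 0 : ℂ), norm_mul (x 1 : ℂ), Complex.norm_real (x 0), Complex.norm_real (x 1),
      Real.norm_eq_abs, Real.norm_eq_abs, add_mul, add_mul, mul_assoc |x 0|, mul_assoc |x 1|]
    gcongr
    · exact hb₀ x φ σ hσ
    · exact hb₁ x φ σ hσ
    · exact hb₂ x φ σ hσ
  · refine Eventually.of_forall fun σ φ _ => ?_
    have h1 : HasDerivAt (fun φ => σ • omega φ) (σ • perp (omega φ)) φ :=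
      (hasDerivAt_omega φ).const_smul σ
    have h2 : HasDerivAt (fun φ => E (σ • omega φ)) (fderiv ℝ E (σ • omega φ) (σ • perp (omega φ)))
        φ := (E.differentiableAt.hasFDerivAt).comp_hasDerivAt φ h1
    have h3 : HasDerivAt (fun φ => (inner ℝ x (σ • omega φ) : ℝ)) (inner ℝ x (σ • perp (omega φ)))
        φ := by
      simpa using (hasDerivAt_const φ x).inner ℝ h1
    have h4 := (h2.mul ((h3.ofReal_comp.const_mul (2 * Real.pi * Complex.I)).cexp)).const_mul (σ : ℂ)
    refine h4.congr_deriv ?_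
    have h5 : perp (σ • omega φ) = σ • perp (omega φ) := by
      ext i
      fin_cases i <;> simp [perp]
    simp only [hP, e0, e1, e2]
    rw [h5]
    simp only [inner_eq, PiLp.smul_apply, perp_zero_coord, perp_one_coord, smul_eq_mul]
    push_cast
    ring

lemma continuous_rayIntegral (E : 𝓢(Plane, ℂ)) (x : Plane) : Continuous (rayIntegral E x) := by
  obtain ⟨E₀, E₁, E₂, h⟩ := exists_hasDerivAt_rayIntegral E
  exact Differentiable.continuous (𝕜 := ℝ) fun φ => (h x φ).differentiableAt

/-! ### Polar coordinates -/

lemma integral_polar (F : Plane → ℂ) : ∫ w, F w =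
    ∫ z in Set.Ioi (0 : ℝ) ×ˢ Set.Ioo (-Real.pi) Real.pi, z.1 • F (z.1 • omega z.2) := by
  have h1 : ∫ w, F w = ∫ z : ℂ, F (Complex.orthonormalBasisOneI.repr z) :=
    (Complex.orthonormalBasisOneI.measurePreserving_repr.integral_comp
      (Complex.orthonormalBasisOneI.repr.toHomeomorph.measurableEmbedding) F).symm
  rw [h1, ← Complex.integral_comp_polarCoord_symm]
  change ∫ z in Set.Ioi (0 : ℝ) ×ˢ Set.Ioo (-Real.pi) Real.pi, _ = _
  congr 1
  funext z
  congr 2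
  ext i
  fin_cases i <;> simp [omega, Complex.cos_ofReal_re, Complex.sin_ofReal_re]

lemma arg_smul_omega {σ φ : ℝ} (hσ : 0 < σ) (hφ : φ ∈ Set.Ioc (-Real.pi) Real.pi) :
    arg (σ • omega φ) = φ := by
  rw [arg]
  have : (⟨(σ • omega φ) 0, (σ • omega φ) 1⟩ : ℂ) =
      σ * (Complex.cos φ + Complex.sin φ * Complex.I) := by
    apply Complex.ext <;> simp [omega, Complex.cos_ofReal_re, Complex.sin_ofReal_re]
  rw [this, Complex.arg_mul_cos_add_sin_mul_I hσ hφ]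

lemma integral_polar_schwartz (E : 𝓢(Plane, ℂ)) (x : Plane) {ρ : ℝ → ℂ} (hρ : Continuous ρ) {B : ℝ}
    (hB : ∀ φ, ‖ρ φ‖ ≤ B) : ∫ w, ρ (arg w) * (E w *
      Complex.exp (2 * Real.pi * Complex.I * (inner ℝ x w : ℝ))) =
        ∫ φ in (-Real.pi)..Real.pi, ρ φ * rayIntegral E x φ := by
  rw [integral_polar, intervalIntegral.integral_of_le (by linarith [Real.pi_pos]),
    integral_Ioc_eq_integral_Ioo, Measure.volume_eq_prod, ← Measure.prod_restrict]
  obtain ⟨C, hC, hb⟩ := exists_bound_ray E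
  have hB0 : 0 ≤ B := (norm_nonneg _).trans (hB 0)
  set G : ℝ × ℝ → ℂ := fun z => ρ z.2 * ((z.1 : ℂ) * (E (z.1 • omega z.2) *
    Complex.exp (2 * Real.pi * Complex.I * (inner ℝ x (z.1 • omega z.2) : ℝ)))) with hG
  have hmem : ∀ᵐ z ∂(volume.restrict (Set.Ioi (0 : ℝ))).prod
      (volume.restrict (Set.Ioo (-Real.pi) Real.pi)),
      z ∈ Set.Ioi (0 : ℝ) ×ˢ Set.Ioo (-Real.pi) Real.pi := by
    rw [Measure.prod_restrict]
    exact ae_restrict_mem (measurableSet_Ioi.prod measurableSet_Ioo)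
  have hGi : Integrable G ((volume.restrict (Set.Ioi (0 : ℝ))).prod
      (volume.restrict (Set.Ioo (-Real.pi) Real.pi))) := by
    have hd : Integrable (fun z : ℝ × ℝ => B * (C * ((1 + |z.1|) ^ 2)⁻¹))
        ((volume.restrict (Set.Ioi (0 : ℝ))).prod
          (volume.restrict (Set.Ioo (-Real.pi) Real.pi))) :=
      Integrable.comp_fst (f := fun σ : ℝ => B * (C * ((1 + |σ|) ^ 2)⁻¹))
        ((integrable_inv_one_add_abs_sq.const_mul C).const_mul B).integrableOn _
    refine hd.mono' ?_ ?_
    · refine Continuous.aestronglyMeasurable ?_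
      have h1 := E.continuous
      have h2 : Continuous omega := Differentiable.continuous (𝕜 := ℝ) fun φ =>
        (hasDerivAt_omega φ).differentiableAt
      fun_prop
    · filter_upwards [hmem] with z hz
      rw [hG, norm_mul]
      exact mul_le_mul (hB _) (hb x z.2 z.1 hz.1) (norm_nonneg _) hB0
  have h1 : ∫ φ in Set.Ioo (-Real.pi) Real.pi, ρ φ * rayIntegral E x φ =
      ∫ z, G z ∂(volume.restrict (Set.Ioi (0 : ℝ))).prod
        (volume.restrict (Set.Ioo (-Real.pi) Real.pi)) := by
    rw [integral_prod_symm _ hGi]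
    congr 1
    funext φ
    rw [rayIntegral, ← integral_const_mul]
  rw [h1]
  refine integral_congr_ae ?_
  filter_upwards [hmem] with z hz
  rw [arg_smul_omega hz.1 ⟨hz.2.1, hz.2.2.le⟩, Complex.real_smul, hG]
  ring

/-! ### Filtered backprojection on the Fourier side -/

lemma rayIntegral_add_two_pi (E : 𝓢(Plane, ℂ)) (x : Plane) (φ : ℝ) :
    rayIntegral E x (φ + 2 * Real.pi) = rayIntegral E x φ := by
  simp only [rayIntegral, omega_add_two_pi]

lemma filteredAt_eq (ψ : Plane → ℂ) {f : Plane → ℂ} (hf : ContDiff ℝ ∞ f)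
    (hc : HasCompactSupport f) (x : Plane) (φ : ℝ) :
    filteredAt ψ f x φ = 1 / 2 * (ψ (omega φ) * (rayIntegral (𝓕 (hc.toSchwartzMap hf)) x φ +
      rayIntegral (𝓕 (hc.toSchwartzMap hf)) x (φ + Real.pi))) := by
  set E : 𝓢(Plane, ℂ) := 𝓕 (hc.toSchwartzMap hf) with hE
  have hEf : ∀ w, E w = 𝓕 f w := fun w => rfl
  have h1 : ∀ σ, 𝓕 (data ψ f φ) σ = ψ (omega φ) * E (σ • omega φ) := by
    intro σ
    rw [hEf, ← fourier_radon hf.continuous hc, Real.fourier_eq', Real.fourier_eq',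
      ← integral_const_mul]
    congr 1
    funext p
    simp only [data, smul_eq_mul]
    ring
  rw [filteredAt, ← dataSchwartz_coe ψ hf hc φ, ramp_eq, dataSchwartz_coe]
  push_cast
  congr 1
  rw [rayIntegral, rayIntegral, ← integral_add (integrableOn_ray E x φ)
    (integrableOn_ray E x (φ + Real.pi)), ← integral_const_mul]
  congr 1
  funext σ
  rw [h1, h1, omega_add_pi, smul_neg, inner_neg_right, real_inner_smul_right, neg_smul]
  push_cast
  ring_nf

lemma exists_tendsto_hilbertTrunc (ψ : Plane → ℂ) {f : Plane → ℂ} (hf : ContDiff ℝ ∞ f)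
    (hc : HasCompactSupport f) (φ p : ℝ) : ∃ l : ℂ,
      Tendsto (hilbertTrunc (deriv (data ψ f φ)) p) (𝓝[>] (0 : ℝ)) (𝓝 l) :=
  ⟨_, tendsto_hilbertTrunc (SchwartzMap.derivCLM ℂ ℂ (dataSchwartz ψ hf hc φ)) p⟩

/-- The angular Fourier coefficient of the filtered data. For `n = 0` this is `fullRecon`. -/
def angularCoeff (ψ f : Plane → ℂ) (n : ℤ) (x : Plane) : ℂ :=
  ∫ φ in (0 : ℝ)..(2 * Real.pi), Complex.exp (2 * Complex.I * n * φ) * filteredAt ψ f x φ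

lemma angularCoeff_zero (ψ f : Plane → ℂ) : angularCoeff ψ f 0 = fullRecon ψ f := by
  funext x
  simp [angularCoeff, fullRecon]

lemma exp_angle_add_pi (n : ℤ) (φ : ℝ) : Complex.exp (2 * Complex.I * n * ((φ + Real.pi : ℝ) : ℂ)) =
    Complex.exp (2 * Complex.I * n * φ) := by
  rw [Complex.exp_eq_exp_iff_exists_int]
  exact ⟨n, by push_cast; ring⟩

lemma norm_exp_angle (n : ℤ) (φ : ℝ) : ‖Complex.exp (2 * Complex.I * n * φ)‖ = 1 := by
  rw [Complex.norm_exp]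
  simp

section Backprojection

variable {ψ : Plane → ℂ} (hψ : ContDiff ℝ ∞ (fun φ : ℝ => ψ (omega φ)))
  (hψ_even : ∀ φ : ℝ, ψ (-omega φ) = ψ (omega φ))
  {f : Plane → ℂ} (hf : ContDiff ℝ ∞ f) (hc : HasCompactSupport f)

include hψ hf hc in
lemma continuous_filteredAt (x : Plane) : Continuous (filteredAt ψ f x) := by
  have h : filteredAt ψ f x = _ := funext (filteredAt_eq ψ hf hc x)
  rw [h]
  have h2 := continuous_rayIntegral (𝓕 (hc.toSchwartzMap hf)) x
  exact continuous_const.mul (hψ.continuous.mul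
    (h2.add (h2.comp (continuous_id.add continuous_const))))

include hψ_even hf hc in
lemma filteredAt_add_pi (x : Plane) : Function.Periodic (filteredAt ψ f x) Real.pi := by
  intro φ
  rw [filteredAt_eq ψ hf hc, filteredAt_eq ψ hf hc, omega_add_pi, hψ_even,
    show φ + Real.pi + Real.pi = φ + 2 * Real.pi by ring, rayIntegral_add_two_pi, add_comm]

include hψ hψ_even hf hc in
lemma angularCoeff_eq (n : ℤ) (x : Plane) : angularCoeff ψ f n x =
    ∫ φ in (0 : ℝ)..(2 * Real.pi), Complex.exp (2 * Complex.I * n * φ) *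
      (ψ (omega φ) * rayIntegral (𝓕 (hc.toSchwartzMap hf)) x φ) := by
  set A : ℝ → ℂ := fun φ => Complex.exp (2 * Complex.I * n * φ) *
      (ψ (omega φ) * rayIntegral (𝓕 (hc.toSchwartzMap hf)) x φ) with hA
  have hAc : Continuous A :=
    (by fun_prop : Continuous fun φ : ℝ => Complex.exp (2 * Complex.I * n * φ)).mul
      (hψ.continuous.mul (continuous_rayIntegral (𝓕 (hc.toSchwartzMap hf)) x))
  have hAp : Function.Periodic A (2 * Real.pi) := by
    intro φ
    simp only [hA, omega_add_two_pi, rayIntegral_add_two_pi]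
    rw [show φ + 2 * Real.pi = φ + Real.pi + Real.pi by ring, exp_angle_add_pi, exp_angle_add_pi]
  have h1 : ∀ φ : ℝ, Complex.exp (2 * Complex.I * n * φ) * filteredAt ψ f x φ =
      1 / 2 * (A φ + A (φ + Real.pi)) := by
    intro φ
    rw [filteredAt_eq ψ hf hc]
    simp only [hA]
    rw [exp_angle_add_pi, omega_add_pi, hψ_even]
    ring
  have h2 : ∫ φ in (0 : ℝ)..(2 * Real.pi), A (φ + Real.pi) = ∫ φ in (0 : ℝ)..(2 * Real.pi), A φ := by
    have := hAp.intervalIntegral_add_eq Real.pi 0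
    rw [intervalIntegral.integral_comp_add_right, zero_add, add_comm (2 * Real.pi), this, zero_add]
  simp_rw [angularCoeff, h1]
  rw [intervalIntegral.integral_const_mul, intervalIntegral.integral_add
    (hAc.intervalIntegrable _ _) (Continuous.intervalIntegrable (by fun_prop) _ _), h2]
  ring

lemma measurable_arg : Measurable arg := by
  have : arg = fun ξ => Complex.arg (toComplex ξ) := by
    funext ξ
    rw [arg, toComplex_apply]
  rw [this]
  exact Complex.measurable_arg.comp toComplex.continuous.measurable

/-- The Fourier transform of `angularCoeff ψ f n`: the product of `exp (2 i n arg w)`, of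
`ψ (w / |w|)` and of the Fourier transform of `f`. -/
def angularSymbol (ψ f : Plane → ℂ) (n : ℤ) (w : Plane) : ℂ :=
  (Complex.exp (2 * Complex.I * n * arg w) * ψ (omega (arg w))) * 𝓕 f w

include hψ in
lemma exists_bound_angularFactor (n : ℤ) : ∃ B, ∀ φ : ℝ,
    ‖Complex.exp (2 * Complex.I * n * φ) * ψ (omega φ)‖ ≤ B := by
  have hper : Function.Periodic (fun φ : ℝ => ψ (omega φ)) (2 * Real.pi) := fun φ => by
    simp only [omega_add_two_pi]
  obtain ⟨B, hB⟩ := isCompact_Icc.exists_bound_of_continuousOn (s := Set.Icc 0 (2 * Real.pi))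
    hψ.continuous.continuousOn
  refine ⟨B, fun φ => ?_⟩
  rw [norm_mul, norm_exp_angle, one_mul]
  obtain ⟨y, hy, h⟩ := hper.exists_mem_Ico₀ (by positivity) φ
  rw [h]
  exact hB y ⟨hy.1, hy.2.le⟩

include hψ hf hc in
lemma memLp_angularSymbol (n : ℤ) (p : ℝ≥0∞) : MemLp (angularSymbol ψ f n) p volume := by
  obtain ⟨B, hB⟩ := exists_bound_angularFactor hψ n
  have hE : MemLp (𝓕 f) p volume := SchwartzMap.memLp (𝓕 (hc.toSchwartzMap hf) : 𝓢(Plane, ℂ)) p volume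
  refine hE.of_le_mul (c := B) ?_ (Eventually.of_forall fun w => ?_)
  · refine AEStronglyMeasurable.mul (Measurable.aestronglyMeasurable ?_) hE.aestronglyMeasurable
    have h1 := measurable_arg
    have h2 : Measurable fun w => ψ (omega (arg w)) := hψ.continuous.measurable.comp h1
    exact (by fun_prop : Measurable fun w => Complex.exp (2 * Complex.I * n * arg w)).mul h2
  · rw [angularSymbol, norm_mul]
    exact mul_le_mul_of_nonneg_right (hB _) (norm_nonneg _)

include hψ hψ_even hf hc in
lemma angularCoeff_eq_fourierInv (n : ℤ) :
    angularCoeff ψ f n = 𝓕⁻ (angularSymbol ψ f n) := by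
  funext x
  obtain ⟨B, hB⟩ := exists_bound_angularFactor hψ n
  have hρ : Continuous fun φ : ℝ => Complex.exp (2 * Complex.I * n * φ) * ψ (omega φ) :=
    (by fun_prop : Continuous fun φ : ℝ => Complex.exp (2 * Complex.I * n * φ)).mul hψ.continuous
  have h1 := integral_polar_schwartz (𝓕 (hc.toSchwartzMap hf)) x hρ hB
  have hper : Function.Periodic (fun φ : ℝ => (Complex.exp (2 * Complex.I * n * φ) * ψ (omega φ)) *
      rayIntegral (𝓕 (hc.toSchwartzMap hf)) x φ) (2 * Real.pi) := by
    intro φ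
    simp only [omega_add_two_pi, rayIntegral_add_two_pi]
    rw [show φ + 2 * Real.pi = φ + Real.pi + Real.pi by ring, exp_angle_add_pi, exp_angle_add_pi]
  have h2 := hper.intervalIntegral_add_eq (-Real.pi) 0
  rw [show -Real.pi + 2 * Real.pi = Real.pi by ring, zero_add] at h2
  rw [angularCoeff_eq hψ hψ_even hf hc, Real.fourierInv_eq']
  simp_rw [← mul_assoc]
  rw [← h2, ← h1]
  congr 1
  funext w
  rw [angularSymbol, smul_eq_mul, real_inner_comm]
  change _ * (𝓕 f w * _) = _
  push_cast
  ring_nf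

include hψ hψ_even hf hc in
lemma continuous_angularCoeff (n : ℤ) : Continuous (angularCoeff ψ f n) := by
  rw [angularCoeff_eq_fourierInv hψ hψ_even hf hc]
  exact VectorFourier.fourierIntegral_continuous Real.continuous_fourierChar
    (by simp only [LinearMap.neg_apply, innerₗ_apply_apply]; fun_prop)
    (memLp_one_iff_integrable.1 (memLp_angularSymbol hψ hf hc n 1))

include hψ hψ_even hf hc in
lemma angularCoeff_ae_eq (n : ℤ) : angularCoeff ψ f n =ᵐ[volume]
    ((𝓕⁻ (memLp_angularSymbol hψ hf hc n 2).toLp : L2) : Plane → ℂ) := by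
  rw [angularCoeff_eq_fourierInv hψ hψ_even hf hc]
  exact (fourierInv_toLp_ae (memLp_one_iff_integrable.1 (memLp_angularSymbol hψ hf hc n 1)) _).symm

include hψ hψ_even hf hc in
lemma memLp_fullRecon : MemLp (fullRecon ψ f) 2 volume := by
  rw [← angularCoeff_zero]
  exact (Lp.memLp _).ae_eq (angularCoeff_ae_eq hψ hψ_even hf hc 0).symm

include hψ hψ_even hf hc in
lemma fourier_fullRecon : ((𝓕 (memLp_fullRecon hψ hψ_even hf hc).toLp : L2) : Plane → ℂ) =ᵐ[volume]
    angularSymbol ψ f 0 := by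
  have h1 : (memLp_fullRecon hψ hψ_even hf hc).toLp =
      𝓕⁻ (memLp_angularSymbol hψ hf hc 0 2).toLp := by
    apply Lp.ext
    refine (MemLp.coeFn_toLp _).trans ?_
    rw [← angularCoeff_zero]
    exact angularCoeff_ae_eq hψ hψ_even hf hc 0
  rw [h1, FourierInvPair.fourier_fourierInv_eq]
  exact MemLp.coeFn_toLp _

lemma omega_arg {w : Plane} (hw : w ≠ 0) : omega (arg w) = ‖w‖⁻¹ • w := by
  have h1 : (‖toComplex w‖ : ℂ) * Complex.exp (arg w * Complex.I) = toComplex w := by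
    rw [arg, ← toComplex_apply]; exact Complex.norm_mul_exp_arg_mul_I _
  rw [norm_toComplex] at h1
  have hn : ‖w‖ ≠ 0 := norm_ne_zero_iff.2 hw
  have h2 : omega (arg w) = ‖w‖⁻¹ • (‖w‖ • omega (arg w)) := (inv_smul_smul₀ hn _).symm
  rw [h2]
  congr 1
  rw [toComplex_apply] at h1
  ext i
  fin_cases i
  · have := congrArg Complex.re h1
    simpa [omega, Complex.exp_ofReal_mul_I_re] using this
  · have := congrArg Complex.im h1
    simpa [omega, Complex.exp_ofReal_mul_I_im] using this

lemma ae_ne_zero_plane : ∀ᵐ w : Plane, w ≠ 0 := by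
  simp [ae_iff, measure_singleton]

lemma phaseFactor_smul {s h : ℝ} {m : ℕ} (hs : 0 < s) (hm : 1 ≤ m) (hh : h = Real.pi / (s * m))
    (k : ℤ) {r : ℝ} (hr : 0 < r) (w : Plane) :
    phaseFactor s h k (r • w) = Complex.exp (2 * Complex.I * (k * m : ℤ) * arg w) := by
  have h1 : arg (r • w) = arg w := by
    have : (⟨(r • w) 0, (r • w) 1⟩ : ℂ) = r * ⟨w 0, w 1⟩ := by
      apply Complex.ext <;> simp
    rw [arg, this, Complex.arg_real_mul _ hr, arg]
  have hm' : (m : ℝ) ≠ 0 := by positivity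
  have hpi := Real.pi_ne_zero
  rw [phaseFactor, h1]
  congr 1
  have h2 : 2 * Real.pi * k * arg w / (s * h) = 2 * (k * m) * arg w := by
    rw [hh]
    field_simp
  rw [h2]
  push_cast
  ring

include hψ hψ_even hf hc in
/-- The artifacts `A_k f_ψ` are angular Fourier coefficients of the filtered data. -/
lemma angularCoeff_ae_eq_aliasOp {s h : ℝ} {m : ℕ} (hs : 0 < s) (hm : 1 ≤ m)
    (hh : h = Real.pi / (s * m)) (k : ℤ) : angularCoeff ψ f (k * m) =ᵐ[volume]
      (aliasOp s h k (memLp_fullRecon hψ hψ_even hf hc).toLp : L2) := by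
  have hpos : 0 < h := by
    have : (0 : ℝ) < m := by exact_mod_cast hm
    have := Real.pi_pos
    rw [hh]; positivity
  have h1 : aliasOp s h k (memLp_fullRecon hψ hψ_even hf hc).toLp =
      𝓕⁻ (memLp_angularSymbol hψ hf hc (k * m) 2).toLp := by
    refine ((Lp.fourierTransformₗᵢ Plane ℂ).symm_apply_apply _).symm.trans
      (congrArg (Lp.fourierTransformₗᵢ Plane ℂ).symm ?_)
    apply Lp.ext
    filter_upwards [fourier_aliasOp s h k (memLp_fullRecon hψ hψ_even hf hc).toLp,
      fourier_fullRecon hψ hψ_even hf hc, (memLp_angularSymbol hψ hf hc (k * m) 2).coeFn_toLp]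
      with w h2 h3 h4
    refine h2.trans ?_
    rw [h3, h4, phaseFactor_smul hs hm hh k (by positivity)]
    simp [angularSymbol]
    ring
  rw [h1]
  exact angularCoeff_ae_eq hψ hψ_even hf hc _

end Backprojection

/-! ### Decay of the angular Fourier coefficients -/

/-- `A x φ` is `n` times continuously differentiable in the angle `φ`, and the derivatives are
bounded for `φ` in `[0, 2 π]`, locally uniformly in `x`. -/
def AngularRegular : ℕ → (Plane → ℝ → ℂ) → Prop
  | 0, A => (∀ x, Continuous (A x)) ∧
      ∀ R : ℝ, ∃ C, ∀ x, ‖x‖ ≤ R → ∀ φ ∈ Set.Icc 0 (2 * Real.pi), ‖A x φ‖ ≤ C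
  | n + 1, A => ∃ A' : Plane → ℝ → ℂ, (∀ x φ, HasDerivAt (A x) (A' x φ) φ) ∧ AngularRegular n A'

lemma AngularRegular.add {n : ℕ} : ∀ {A B : Plane → ℝ → ℂ}, AngularRegular n A →
    AngularRegular n B → AngularRegular n fun x φ => A x φ + B x φ := by
  induction n with
  | zero =>
    rintro A B ⟨hA, hA'⟩ ⟨hB, hB'⟩
    refine ⟨fun x => (hA x).add (hB x), fun R => ?_⟩
    obtain ⟨C, hC⟩ := hA' R
    obtain ⟨D, hD⟩ := hB' R
    exact ⟨C + D, fun x hx φ hφ => norm_add_le_of_le (hC x hx φ hφ) (hD x hx φ hφ)⟩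
  | succ n ih =>
    rintro A B ⟨A', hA, hA'⟩ ⟨B', hB, hB'⟩
    exact ⟨_, fun x φ => (hA x φ).add (hB x φ), ih hA' hB'⟩

lemma AngularRegular.coord_mul {n : ℕ} (i : Fin 2) : ∀ {A : Plane → ℝ → ℂ}, AngularRegular n A →
    AngularRegular n fun x φ => x i * A x φ := by
  induction n with
  | zero =>
    rintro A ⟨hA, hA'⟩
    refine ⟨fun x => continuous_const.mul (hA x), fun R => ?_⟩
    obtain ⟨C, hC⟩ := hA' R
    refine ⟨R * C, fun x hx φ hφ => ?_⟩
    rw [norm_mul, Complex.norm_real]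
    have h1 : ‖x i‖ ≤ R := (PiLp.norm_apply_le x i).trans hx
    exact mul_le_mul h1 (hC x hx φ hφ) (norm_nonneg _) ((norm_nonneg _).trans h1)
  | succ n ih =>
    rintro A ⟨A', hA, hA'⟩
    exact ⟨_, fun x φ => (hA x φ).const_mul _, ih hA'⟩

lemma angularRegular_mul_rayIntegral (n : ℕ) : ∀ {q : ℝ → ℂ}, ContDiff ℝ ∞ q →
    ∀ E : 𝓢(Plane, ℂ), AngularRegular n fun x φ => q φ * rayIntegral E x φ := by
  induction n with
  | zero =>
    intro q hq E
    refine ⟨fun x => hq.continuous.mul (continuous_rayIntegral E x), fun R => ?_⟩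
    obtain ⟨C, hC, h⟩ := exists_bound_rayIntegral E
    obtain ⟨B, hB⟩ := isCompact_Icc.exists_bound_of_continuousOn (s := Set.Icc 0 (2 * Real.pi))
      hq.continuous.continuousOn
    refine ⟨B * C, fun x _ φ hφ => ?_⟩
    rw [norm_mul]
    exact mul_le_mul (hB φ hφ) (h x φ) (norm_nonneg _) ((norm_nonneg _).trans (hB φ hφ))
  | succ n ih =>
    intro q hq E
    obtain ⟨E₀, E₁, E₂, h⟩ := exists_hasDerivAt_rayIntegral E
    have hq' : ContDiff ℝ ∞ (deriv q) := (contDiff_infty_iff_deriv.1 hq).2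
    refine ⟨_, fun x φ => ?_, (((ih hq' E).add (ih hq E₀)).add ((ih hq E₁).coord_mul 0)).add
      ((ih hq E₂).coord_mul 1)⟩
    refine ((hq.differentiable (by simp) φ).hasDerivAt.mul (h x φ)).congr_deriv ?_
    ring

lemma integral_exp_mul_deriv {A A' : ℝ → ℂ} (hA : ∀ φ, HasDerivAt A (A' φ) φ)
    (hA' : Continuous A') (hper : Function.Periodic A (2 * Real.pi)) (n : ℤ) :
    ∫ φ in (0 : ℝ)..(2 * Real.pi), Complex.exp (2 * Complex.I * n * φ) * A' φ =
      -(2 * Complex.I * n) * ∫ φ in (0 : ℝ)..(2 * Real.pi),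
        Complex.exp (2 * Complex.I * n * φ) * A φ := by
  have h1 : ∀ φ : ℝ, HasDerivAt (fun φ : ℝ => Complex.exp (2 * Complex.I * n * φ))
      (Complex.exp (2 * Complex.I * n * φ) * (2 * Complex.I * n)) φ := by
    intro φ
    have h2 : HasDerivAt (fun φ : ℝ => 2 * Complex.I * n * (φ : ℂ)) (2 * Complex.I * n) φ := by
      simpa using (Complex.ofRealCLM.hasDerivAt (x := φ)).const_mul (2 * Complex.I * n)
    exact h2.cexp
  rw [intervalIntegral.integral_mul_deriv_eq_deriv_mul (fun φ _ => h1 φ) (fun φ _ => hA φ)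
    (Continuous.intervalIntegrable (by fun_prop) _ _) (hA'.intervalIntegrable _ _),
    ← intervalIntegral.integral_const_mul]
  have h2 : A (2 * Real.pi) = A 0 := by simpa using hper 0
  have h3 : Complex.exp (2 * Complex.I * n * ((2 * Real.pi : ℝ) : ℂ)) =
      Complex.exp (2 * Complex.I * n * ((0 : ℝ) : ℂ)) := by
    rw [show (2 * Real.pi : ℝ) = 0 + Real.pi + Real.pi by ring, exp_angle_add_pi, exp_angle_add_pi]
  rw [h2, h3, sub_self, zero_sub, ← intervalIntegral.integral_neg]
  congr 1
  funext φ
  ring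

/-- Two integrations by parts in the angle. -/
lemma exists_norm_integral_exp_angle_le {A : Plane → ℝ → ℂ} (hA : AngularRegular 2 A)
    (hper : ∀ x, Function.Periodic (A x) (2 * Real.pi)) (R : ℝ) :
    ∃ C, ∀ x, ‖x‖ ≤ R → ∀ n : ℤ,
      ‖∫ φ in (0 : ℝ)..(2 * Real.pi), Complex.exp (2 * Complex.I * n * φ) * A x φ‖ * (n : ℝ) ^ 2 ≤
        C := by
  obtain ⟨A', hA', A'', hA'', hcont, hbound⟩ := hA
  obtain ⟨C, hC⟩ := hbound R
  have hper' : ∀ x, Function.Periodic (A' x) (2 * Real.pi) := by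
    intro x φ
    have h1 : HasDerivAt (fun φ => A x (φ + 2 * Real.pi)) (A' x (φ + 2 * Real.pi)) φ :=
      (hA' x (φ + 2 * Real.pi)).comp_add_const φ (2 * Real.pi)
    have h2 : (fun φ => A x (φ + 2 * Real.pi)) = A x := funext (hper x)
    rw [h2] at h1
    exact h1.unique (hA' x φ)
  have hA'c : ∀ x, Continuous (A' x) := fun x =>
    Differentiable.continuous (𝕜 := ℝ) fun φ => (hA'' x φ).differentiableAt
  refine ⟨C * (2 * Real.pi) / 4, fun x hx n => ?_⟩
  have h1 := integral_exp_mul_deriv (hA'' x) (hcont x) (hper' x) n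
  rw [integral_exp_mul_deriv (hA' x) (hA'c x) (hper x) n] at h1
  have h2 : ‖∫ φ in (0 : ℝ)..(2 * Real.pi), Complex.exp (2 * Complex.I * n * φ) * A'' x φ‖ ≤
      C * (2 * Real.pi) := by
    have := intervalIntegral.norm_integral_le_of_norm_le_const (a := (0 : ℝ)) (b := 2 * Real.pi)
      (C := C) (f := fun φ : ℝ => Complex.exp (2 * Complex.I * n * φ) * A'' x φ) (fun φ hφ => by
        rw [norm_mul, norm_exp_angle, one_mul]
        rw [Set.uIoc_of_le (by positivity)] at hφ
        exact hC x hx φ ⟨hφ.1.le, hφ.2⟩)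
    rwa [sub_zero, abs_of_pos (by positivity)] at this
  have h3 : ‖-(2 * Complex.I * (n : ℂ))‖ = 2 * |(n : ℝ)| := by simp
  rw [h1, norm_mul, norm_mul, h3] at h2
  rw [← sq_abs]
  linarith

/-! ### The trapezoidal rule and aliasing -/

lemma periodic_sum_shift {G : ℝ → ℂ} {m : ℕ} {T : ℝ} (hG : Function.Periodic G (m * T)) :
    Function.Periodic (fun φ => ∑ j ∈ Finset.range m, G (φ + (j + 1 : ℕ) * T)) T := by
  intro φ
  have h1 := Finset.sum_range_succ (fun j : ℕ => G (φ + (j + 1 : ℕ) * T)) m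
  rw [Finset.sum_range_succ'] at h1
  have h2 : G (φ + (m + 1 : ℕ) * T) = G (φ + (0 + 1 : ℕ) * T) := by
    rw [← hG (φ + (0 + 1 : ℕ) * T)]
    push_cast
    ring_nf
  rw [h2] at h1
  change _ = ∑ j ∈ Finset.range m, G (φ + (j + 1 : ℕ) * T)
  rw [← add_right_cancel h1]
  refine Finset.sum_congr rfl fun j _ => ?_
  push_cast
  ring_nf

lemma integral_sum_shift {P : ℝ → ℂ} (hP : Continuous P) {m : ℕ} {T : ℝ}
    (hper : Function.Periodic P (m * T)) :
    ∫ φ in (0 : ℝ)..T, ∑ j ∈ Finset.range m, P (φ + (j + 1 : ℕ) * T) =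
      ∫ φ in (0 : ℝ)..(m * T), P φ := by
  rw [intervalIntegral.integral_finsetSum fun j _ =>
    (Continuous.intervalIntegrable (by fun_prop) _ _)]
  have h3 := intervalIntegral.sum_integral_adjacent_intervals (μ := volume) (f := P)
    (a := fun j : ℕ => (j + 1 : ℕ) * T) (n := m) fun j _ => hP.intervalIntegrable _ _
  have e1 : ((0 + 1 : ℕ) : ℝ) * T = T := by push_cast; ring
  have e2 : ((m + 1 : ℕ) : ℝ) * T = T + m * T := by push_cast; ring
  have h4 := hper.intervalIntegral_add_eq T 0
  rw [zero_add] at h4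
  rw [e1, e2, h4] at h3
  rw [← h3]
  refine Finset.sum_congr rfl fun j _ => ?_
  rw [intervalIntegral.integral_comp_add_right, zero_add]
  congr 1
  push_cast
  ring

/-- Fourier inversion at `0` for a continuous function of period `T`. -/
lemma hasSum_integral_exp_periodic {S : ℝ → ℂ} {T : ℝ} (hT : 0 < T) (hS : Continuous S)
    (hper : Function.Periodic S T)
    (hsum : Summable fun k : ℤ =>
      ∫ φ in (0 : ℝ)..T, Complex.exp (2 * Real.pi * Complex.I * k * φ / T) * S φ) :
    HasSum (fun k : ℤ =>
      ∫ φ in (0 : ℝ)..T, Complex.exp (2 * Real.pi * Complex.I * k * φ / T) * S φ) (T * S 0) := by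
  have : Fact (0 < T) := ⟨hT⟩
  have hT' : (T : ℂ) ≠ 0 := by exact_mod_cast hT.ne'
  let F : C(AddCircle T, ℂ) := ⟨hper.lift, continuous_coinduced_dom.mpr hS⟩
  have hF : ∀ φ : ℝ, F φ = S φ := fun φ => hper.lift_coe φ
  have hcoeff : ∀ k : ℤ, fourierCoeff F (-k) = (T : ℂ)⁻¹ *
      ∫ φ in (0 : ℝ)..T, Complex.exp (2 * Real.pi * Complex.I * k * φ / T) * S φ := by
    intro k
    rw [fourierCoeff_eq_intervalIntegral _ _ 0, zero_add, Complex.real_smul, neg_neg]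
    simp_rw [hF, smul_eq_mul, fourier_coe_apply]
    push_cast
    rw [one_div]
  have hcs : Summable (fourierCoeff F) := by
    rw [← (Equiv.neg ℤ).summable_iff]
    exact (hsum.mul_left (T : ℂ)⁻¹).congr fun k => (hcoeff k).symm
  have h1 := has_pointwise_sum_fourier_series_of_summable hcs ((0 : ℝ) : AddCircle T)
  rw [hF, ← (Equiv.neg ℤ).hasSum_iff] at h1
  refine (h1.mul_left (T : ℂ)).congr_fun fun k => ?_
  simp only [Function.comp_apply, Equiv.neg_apply]
  rw [hcoeff, AddCircle.coe_zero, fourier_eval_zero, smul_eq_mul, mul_one,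
    mul_inv_cancel_left₀ hT']

/-- Poisson summation for the trapezoidal rule: equidistant samples of a function of period `π` see
exactly the Fourier coefficients whose index is a multiple of the number of samples. -/
lemma hasSum_trapezoid {G : ℝ → ℂ} (hG : Continuous G) (hper : Function.Periodic G Real.pi) {m : ℕ}
    (hm : 1 ≤ m) (hsum : Summable fun k : ℤ => ∫ φ in (0 : ℝ)..(2 * Real.pi),
      Complex.exp (2 * Complex.I * (k * m : ℤ) * φ) * G φ) :
    HasSum (fun k : ℤ => ∫ φ in (0 : ℝ)..(2 * Real.pi),
      Complex.exp (2 * Complex.I * (k * m : ℤ) * φ) * G φ)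
      ((2 * Real.pi / m : ℝ) * ∑ j ∈ Finset.Icc 1 m, G (Real.pi / m * j)) := by
  have hm0 : (0 : ℝ) < m := by exact_mod_cast hm
  have hm' : (m : ℂ) ≠ 0 := by exact_mod_cast hm0.ne'
  have hpi : (Real.pi : ℂ) ≠ 0 := by exact_mod_cast Real.pi_ne_zero
  obtain ⟨T, hT⟩ : ∃ T : ℝ, T = Real.pi / m := ⟨_, rfl⟩
  have hTpos : 0 < T := hT ▸ div_pos Real.pi_pos hm0
  have hmT : (m : ℝ) * T = Real.pi := by rw [hT]; field_simp
  -- the sum of the shifted functions has period `T`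
  obtain ⟨S, hS⟩ : ∃ S : ℝ → ℂ, S = fun φ => ∑ j ∈ Finset.range m, G (φ + (j + 1 : ℕ) * T) :=
    ⟨_, rfl⟩
  have hSc : Continuous S := by rw [hS]; fun_prop
  have hSper : Function.Periodic S T := by
    rw [hS]
    exact periodic_sum_shift (by rwa [hmT])
  -- the `m` shifts of `[0, T]` cover one period `π`, and `[0, 2 π]` consists of two of them
  have hcoeff : ∀ k : ℤ, ∫ φ in (0 : ℝ)..(2 * Real.pi),
      Complex.exp (2 * Complex.I * (k * m : ℤ) * φ) * G φ = 2 *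
        ∫ φ in (0 : ℝ)..T, Complex.exp (2 * Real.pi * Complex.I * k * φ / T) * S φ := by
    intro k
    obtain ⟨P, hP⟩ : ∃ P : ℝ → ℂ, P = fun φ : ℝ =>
      Complex.exp (2 * Complex.I * (k * m : ℤ) * φ) * G φ := ⟨_, rfl⟩
    have hPc : Continuous P := by rw [hP]; fun_prop
    have hPper : Function.Periodic P Real.pi := by
      intro φ
      simp only [hP]
      rw [exp_angle_add_pi, hper φ]
    have h1 : ∀ φ : ℝ, Complex.exp (2 * Real.pi * Complex.I * k * φ / T) * S φ =
        ∑ j ∈ Finset.range m, P (φ + (j + 1 : ℕ) * T) := by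
      intro φ
      simp only [hS, hP, Finset.mul_sum]
      refine Finset.sum_congr rfl fun j _ => ?_
      congr 1
      rw [Complex.exp_eq_exp_iff_exists_int]
      refine ⟨-(k * (j + 1 : ℕ)), ?_⟩
      rw [hT]
      push_cast
      field_simp
      ring
    simp_rw [h1]
    rw [integral_sum_shift hPc (by rwa [hmT]), hmT]
    have h6 := hPper.intervalIntegral_add_eq Real.pi 0
    rw [zero_add] at h6
    calc _ = ∫ φ in (0 : ℝ)..(2 * Real.pi), P φ := by rw [hP]
      _ = _ := by
        rw [← intervalIntegral.integral_add_adjacent_intervals (b := Real.pi)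
          (hPc.intervalIntegrable _ _) (hPc.intervalIntegrable _ _),
          show 2 * Real.pi = Real.pi + Real.pi by ring, h6]
        ring
  have hS0 : S 0 = ∑ j ∈ Finset.Icc 1 m, G (Real.pi / m * j) := by
    rw [← Finset.Ico_add_one_right_eq_Icc, Finset.sum_Ico_eq_sum_range, hS]
    refine Finset.sum_congr (by simp) fun j _ => ?_
    rw [hT, zero_add, mul_comm, add_comm j 1]
  simp_rw [hcoeff] at hsum ⊢
  have h1 := (hasSum_integral_exp_periodic hTpos hSc hSper
    ((summable_mul_left_iff two_ne_zero).1 hsum)).mul_left 2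
  convert! h1 using 1
  rw [hS0, hT]
  push_cast
  ring

section Aliasing

variable {ψ : Plane → ℂ} (hψ : ContDiff ℝ ∞ (fun φ : ℝ => ψ (omega φ)))
  (hψ_even : ∀ φ : ℝ, ψ (-omega φ) = ψ (omega φ))
  {f : Plane → ℂ} (hf : ContDiff ℝ ∞ f) (hc : HasCompactSupport f)

include hψ hψ_even hf hc in
lemma exists_norm_angularCoeff_le (R : ℝ) :
    ∃ C, ∀ x, ‖x‖ ≤ R → ∀ n : ℤ, ‖angularCoeff ψ f n x‖ * (n : ℝ) ^ 2 ≤ C := by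
  obtain ⟨C, hC⟩ := exists_norm_integral_exp_angle_le
    (angularRegular_mul_rayIntegral 2 hψ (𝓕 (hc.toSchwartzMap hf)))
    (fun x φ => by simp only [omega_add_two_pi, rayIntegral_add_two_pi]) R
  refine ⟨C, fun x hx n => ?_⟩
  rw [angularCoeff_eq hψ hψ_even hf hc]
  exact hC x hx n

include hψ hψ_even hf hc in
lemma exists_norm_angularCoeff_mul_le {m : ℕ} (hm : 1 ≤ m) (R : ℝ) :
    ∃ C, ∀ x, ‖x‖ ≤ R → ∀ k : {k : ℤ // k ≠ 0},
      ‖angularCoeff ψ f (k * m) x‖ ≤ C * (1 / ((k : ℤ) : ℝ) ^ 2) := by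
  obtain ⟨C, hC⟩ := exists_norm_angularCoeff_le hψ hψ_even hf hc R
  refine ⟨C, fun x hx k => ?_⟩
  have h1 := hC x hx (k * m)
  have hk : (0 : ℝ) < ((k : ℤ) : ℝ) ^ 2 := by
    have : ((k : ℤ) : ℝ) ≠ 0 := by exact_mod_cast k.2
    positivity
  have hm' : (1 : ℝ) ≤ (m : ℝ) ^ 2 := one_le_pow₀ (by exact_mod_cast hm)
  rw [mul_one_div, le_div_iff₀ hk]
  refine le_trans (mul_le_mul_of_nonneg_left ?_ (norm_nonneg _)) h1
  push_cast
  rw [mul_pow]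
  exact le_mul_of_one_le_right hk.le hm'

lemma summable_one_div_sq_ne_zero (C : ℝ) :
    Summable fun k : {k : ℤ // k ≠ 0} => C * (1 / ((k : ℤ) : ℝ) ^ 2) :=
  ((Real.summable_one_div_int_pow.2 one_lt_two).subtype _).mul_left C

include hψ hψ_even hf hc in
/-- The pointwise expansion: the coefficient of index `0` of the trapezoidal rule is `fullRecon`. -/
lemma hasSum_angularCoeff {s h : ℝ} {m : ℕ} (hs : 0 < s) (hm : 1 ≤ m)
    (hh : h = Real.pi / (s * m)) (x : Plane) :
    HasSum (fun k : {k : ℤ // k ≠ 0} => angularCoeff ψ f (k * m) x)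
      (directRecon ψ f s h m x - fullRecon ψ f x) := by
  obtain ⟨C, hC⟩ := exists_norm_angularCoeff_mul_le hψ hψ_even hf hc hm ‖x‖
  have h1 : Summable fun k : {k : ℤ // k ≠ 0} => angularCoeff ψ f (k * m) x :=
    Summable.of_norm_bounded (summable_one_div_sq_ne_zero C) (hC x le_rfl)
  have hne : ∀ k : ℤ, k ∉ ({0} : Finset ℤ) ↔ k ≠ 0 := fun k => by simp
  have h2 : Summable fun k : ℤ => angularCoeff ψ f (k * m) x := by
    rw [← Finset.summable_compl_iff {0}]
    exact (Equiv.subtypeEquivRight hne).summable_iff.2 h1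
  have h3 := hasSum_trapezoid (continuous_filteredAt hψ hf hc x)
    (filteredAt_add_pi hψ_even hf hc x) hm h2
  have hsh : s * h = Real.pi / m := by rw [hh]; field_simp
  have h4 : (2 * Real.pi / m : ℝ) * ∑ j ∈ Finset.Icc 1 m, filteredAt ψ f x (Real.pi / m * j) =
      directRecon ψ f s h m x := by
    rw [directRecon, mul_assoc 2 s h, hsh, mul_div_assoc]
  have h5 : fullRecon ψ f x = ∑ k ∈ ({0} : Finset ℤ), angularCoeff ψ f (k * m) x := by
    rw [Finset.sum_singleton, zero_mul, angularCoeff_zero]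
  rw [← (Equiv.subtypeEquivRight hne).hasSum_iff, h5]
  refine (Finset.hasSum_compl_iff (f := fun k : ℤ => angularCoeff ψ f (k * m) x) {0}).2 ?_
  rw [sub_add_cancel, ← h4]
  exact h3

include hψ hψ_even hf hc in
lemma hasSumLocallyUniformly_angularCoeff {s h : ℝ} {m : ℕ} (hs : 0 < s) (hm : 1 ≤ m)
    (hh : h = Real.pi / (s * m)) :
    HasSumLocallyUniformly (fun k : {k : ℤ // k ≠ 0} => angularCoeff ψ f (k * m))
      (fun x => directRecon ψ f s h m x - fullRecon ψ f x) := by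
  refine hasSumLocallyUniformly_of_of_forall_exists_nhds fun x => ?_
  refine ⟨Metric.ball x 1, Metric.ball_mem_nhds x one_pos, ?_⟩
  obtain ⟨C, hC⟩ := exists_norm_angularCoeff_mul_le hψ hψ_even hf hc hm (‖x‖ + 1)
  have h1 := HasSumUniformlyOn.of_norm_le_summable (summable_one_div_sq_ne_zero C)
    (s := Metric.ball x 1) (f := fun (k : {k : ℤ // k ≠ 0}) y => angularCoeff ψ f (k * m) y)
    fun k y hy => hC y (by
      have h2 := norm_sub_norm_le y x
      rw [Metric.mem_ball, dist_eq_norm] at hy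
      linarith) k
  exact h1.congr_right fun y _ => (hasSum_angularCoeff hψ hψ_even hf hc hs hm hh y).tsum_eq

end Aliasing

end DirectRecon

end

theorem theorem4p1 (s : ℝ) (hs : 0 < s) (ψ : Plane → ℂ)
    (hψ : ContDiff ℝ ∞ (fun φ : ℝ => ψ (omega φ)))
    (hψ_even : ∀ φ : ℝ, ψ (-omega φ) = ψ (omega φ))
    (f : ℝ → Plane → ℂ) (hf : IsBandLimited (admissible s) f) :
    -- the reconstruction formula
    (∀ (m : ℕ) (h : ℝ), 1 ≤ m → h = Real.pi / (s * m) →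
      -- the principal values and the integral over the circle exist
      (∀ φ p : ℝ, ∃ l : ℂ,
        Tendsto (hilbertTrunc (deriv (data ψ (f h) φ)) p) (𝓝[>] (0 : ℝ)) (𝓝 l)) ∧
      (∀ x : Plane,
        IntervalIntegrable (filteredAt ψ (f h) x) volume 0 (2 * Real.pi)) ∧
      -- the full-angle reconstruction is square integrable and equals `ψ(D/|D|) f`
      ∃ hL : MemLp (fullRecon ψ (f h)) 2 volume,
        (∀ᵐ w : Plane, (𝓕 hL.toLp : L2) w = ψ (‖w‖⁻¹ • w) * 𝓕 (f h) w) ∧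
        -- each `A_k f_ψ` has a continuous representative, and these sum to the artifacts
        ∃ u : ℤ → Plane → ℂ,
          (∀ k, Continuous (u k) ∧ u k =ᵐ[volume] (aliasOp s h k hL.toLp : L2)) ∧
          HasSumLocallyUniformly (fun k : {k : ℤ // k ≠ 0} => u k)
            (fun x => directRecon ψ (f h) s h m x - fullRecon ψ (f h) x)) ∧
    -- unitarity
    (∀ h ∈ admissible s, ∀ k : ℤ, aliasOp s h k ∈ unitary (L2 →L[ℂ] L2)) ∧
    -- elliptic Fourier integral operators of order zero
    (∀ k : ℤ, IsEllipticFIO (admissible s) (fun h => aliasOp s h k) (canonicalRelation s k) 0) := by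
  have hcs : ∀ h ∈ admissible s, HasCompactSupport (f h) := fun h hh => by
    obtain ⟨K, hK, hsub⟩ := hf.support
    exact hK.of_isClosed_subset (isClosed_tsupport _) (hsub h hh)
  refine ⟨fun m h hm hh => ?_, fun h _ k => aliasOp_mem_unitary s h k,
    fun k => isEllipticFIO_aliasOp hs k⟩
  have hadm : h ∈ admissible s := ⟨m, hm, hh⟩
  have hsm := hf.smooth h hadm
  have hc := hcs h hadm
  refine ⟨exists_tendsto_hilbertTrunc ψ hsm hc,
    fun x => (continuous_filteredAt hψ hsm hc x).intervalIntegrable _ _,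
    memLp_fullRecon hψ hψ_even hsm hc, ?_, fun k => angularCoeff ψ (f h) (k * m),
    fun k => ⟨continuous_angularCoeff hψ hψ_even hsm hc _,
      angularCoeff_ae_eq_aliasOp hψ hψ_even hsm hc hs hm hh k⟩,
    hasSumLocallyUniformly_angularCoeff hψ hψ_even hsm hc hs hm hh⟩
  filter_upwards [fourier_fullRecon hψ hψ_even hsm hc, ae_ne_zero_plane] with w h1 h2
  rw [h1, angularSymbol, omega_arg h2]
  simp
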